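/- Let $A$ and $B$ be quantum systems with Hilbert spaces $\mathbb C^{d_A}$ and $\mathbb C^{d_B}$, and put $d=\min(d_A,d_B)$. For a density matrix $\rho$ on $\mathbb C^{d_A}\otimes\mathbb C^{d_B}$ let $E(\rho)=\inf_{\sigma}S(\rho\Vert\sigma)$ be its relative entropy of entanglement, where $\sigma$ runs over the separable states (convex combinations of products of density matrices) and $S(\rho\Vert\sigma)=\operatorname{Tr}\rho(\log\rho-\log\sigma)$ if $\operatorname{supp}\rho\subseteq\operatorname{supp}\sigma$, $S(\rho\Vert\sigma)=+\infty$ otherwise. For a unit vector $\psi\in\mathbb C^{d_A}\otimes\mathbb C^{d_B}$ and a Hermitian operator $H$ define the entanglement generation rate $$\Gamma(\psi,H)=\frac{d}{dt}E\big(e^{-iHt}|\psi\rangle\langle\psi|e^{iHt}\big)\Big|_{t=0},$$ the mean energy $\bar E_\psi=\langle\psi|H|\psi\rangle$ and the variance $\Delta E^2(\psi,H)=\langle\psi|H^2|\psi\rangle-\langle\psi|H|\psi\rangle^2$. (0) The derivative defining $\Gamma(\psi,H)$ exists for all such $\psi$ and $H$. (1) Bounding the mean energy does not bound $\Gamma$: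 if $d_A,d_B\ge 2$, there is a unit vector $\psi$ such that for all real $e$ and $K$ there is a Hermitian $H$ with $\langle\psi|H|\psi\rangle=e$ and $\Gamma(\psi,H)>K$. (2) Bounding the variance does: for every $b$ there is a constant $K$, depending only on $b$ and $d$, such that $|\Gamma(\psi,H)|\le K$ for all unit vectors $\psi$ and Hermitian $H$ with $\Delta E^2(\psi,H)\le b$. (3) More precisely, let $\psi=\sum_{i=1}^{d}C_i|i\rangle_A|i\rangle_B$ be any Schmidt decomposition ($C_i\ge 0$, both families orthonormal), and let $k_i=\sum_{j=1}^{d}H_{I,ij}C_j$, where $H_{I,ij}$ is the imaginary part of $\langle ii|H|jj\rangle$. Then $$\Gamma(\psi,H)=-4\sum_{i=1}^{d}k_iC_i\log C_i\qquad\text{and}\qquad \sum_{i=1}^{d}k_i^2\le\Delta E^2(\psi,H),$$ with the convention $0\log 0=0$; in particular $\sum_i k_i^2\le b$ whenever $\Delta E^2(\psi,H)\le b$. -/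

import Mathlib

open scoped Matrix Kronecker ComplexOrder

noncomputable section

namespace EntRate

/-- Operators on the bipartite system `ℂ^dA ⊗ ℂ^dB`, written in the product basis. -/
abbrev BiOp (dA dB : ℕ) : Type := Matrix (Fin dA × Fin dB) (Fin dA × Fin dB) ℂ

/-- Vectors of the bipartite system `ℂ^dA ⊗ ℂ^dB`, with the Hilbert space norm. -/
abbrev BiVec (dA dB : ℕ) : Type := EuclideanSpace ℂ (Fin dA × Fin dB)

/-- Density matrices. -/
def IsDensity {n : Type*} [Fintype n] (ρ : Matrix n n ℂ) : Prop :=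
  ρ.PosSemidef ∧ ρ.trace = 1

/-- Separable states: convex combinations of products of density matrices. -/
def separableStates (dA dB : ℕ) : Set (BiOp dA dB) :=
  convexHull ℝ {σ | ∃ (α : Matrix (Fin dA) (Fin dA) ℂ) (β : Matrix (Fin dB) (Fin dB) ℂ),
    IsDensity α ∧ IsDensity β ∧ σ = α ⊗ₖ β}

open Classical in
/-- Quantum relative entropy `S(ρ‖σ) = Tr ρ (log ρ - log σ)` if `supp ρ ⊆ supp σ`
(that is, `ker σ ⊆ ker ρ`), and `+∞` otherwise. The logarithm is the functional calculus of
`Real.log`, which is `0` on the kernel. -/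
def relEntropy {n : Type*} [Fintype n] [DecidableEq n] (ρ σ : Matrix n n ℂ) : EReal :=
  if ∀ v : n → ℂ, σ *ᵥ v = 0 → ρ *ᵥ v = 0 then
    (((ρ * (cfc Real.log ρ - cfc Real.log σ)).trace.re : ℝ) : EReal)
  else ⊤

/-- Relative entropy of entanglement: the infimum of `S(ρ‖σ)` over separable `σ`. -/
def relEntropyEntanglement {dA dB : ℕ} (ρ : BiOp dA dB) : ℝ :=
  (⨅ σ ∈ separableStates dA dB, relEntropy ρ σ).toReal

/-- The pure state `|ψ⟩⟨ψ|`. -/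
def pureState {n : Type*} (ψ : EuclideanSpace ℂ n) : Matrix n n ℂ :=
  Matrix.of fun x y => ψ x * star (ψ y)

/-- The unitary evolution `e^{-iHt}`. -/
def evolution {n : Type*} [Fintype n] [DecidableEq n] (H : Matrix n n ℂ) (t : ℝ) :
    Matrix n n ℂ :=
  NormedSpace.exp ((-(Complex.I * (t : ℂ))) • H)

/-- The entanglement `E(e^{-iHt} |ψ⟩⟨ψ| e^{iHt})` at time `t`. -/
def entanglementAt {dA dB : ℕ} (ψ : BiVec dA dB) (H : BiOp dA dB) (t : ℝ) : ℝ :=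
  relEntropyEntanglement (evolution H t * pureState ψ * (evolution H t)ᴴ)

/-- The entanglement generation rate `Γ(ψ,H)`. -/
def entRate {dA dB : ℕ} (ψ : BiVec dA dB) (H : BiOp dA dB) : ℝ :=
  deriv (entanglementAt ψ H) 0

/-- The matrix element `⟨φ|H|ψ⟩`. -/
def matElem {n : Type*} [Fintype n] [DecidableEq n]
    (φ : EuclideanSpace ℂ n) (H : Matrix n n ℂ) (ψ : EuclideanSpace ℂ n) : ℂ :=
  inner ℂ φ (Matrix.toEuclideanLin H ψ)

/-- The mean energy `⟨ψ|H|ψ⟩`. -/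
def meanEnergy {n : Type*} [Fintype n] [DecidableEq n]
    (ψ : EuclideanSpace ℂ n) (H : Matrix n n ℂ) : ℝ :=
  (matElem ψ H ψ).re

/-- The energy variance `ΔE²(ψ,H) = ⟨ψ|H²|ψ⟩ - ⟨ψ|H|ψ⟩²`. -/
def energyVariance {n : Type*} [Fintype n] [DecidableEq n]
    (ψ : EuclideanSpace ℂ n) (H : Matrix n n ℂ) : ℝ :=
  (matElem ψ (H ^ 2) ψ).re - meanEnergy ψ H ^ 2

/-- The product vector `|a⟩|b⟩`. -/
def prodVec {dA dB : ℕ} (a : EuclideanSpace ℂ (Fin dA)) (b : EuclideanSpace ℂ (Fin dB)) :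
    BiVec dA dB :=
  WithLp.toLp 2 fun x => a x.1 * b x.2

/-- A Schmidt decomposition `ψ = ∑ᵢ Cᵢ |i⟩_A |i⟩_B` with `min(dA,dB)` terms,
`Cᵢ ≥ 0`, and orthonormal families `|i⟩_A`, `|i⟩_B`. -/
structure IsSchmidt {dA dB : ℕ} (ψ : BiVec dA dB) (C : Fin (min dA dB) → ℝ)
    (a : Fin (min dA dB) → EuclideanSpace ℂ (Fin dA))
    (b : Fin (min dA dB) → EuclideanSpace ℂ (Fin dB)) : Prop where
  nonneg : ∀ i, 0 ≤ C i
  orthoA : Orthonormal ℂ a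
  orthoB : Orthonormal ℂ b
  decomp : ψ = ∑ i, (C i : ℂ) • prodVec (a i) (b i)

/-- `kᵢ = ∑ⱼ H_{I,ij} Cⱼ`, where `H_{I,ij}` is the imaginary part of `⟨ii|H|jj⟩` in the
Schmidt basis. -/
def imagCoeff {dA dB : ℕ} (H : BiOp dA dB) (C : Fin (min dA dB) → ℝ)
    (a : Fin (min dA dB) → EuclideanSpace ℂ (Fin dA))
    (b : Fin (min dA dB) → EuclideanSpace ℂ (Fin dB)) (i : Fin (min dA dB)) : ℝ :=
  ∑ j, (matElem (prodVec (a i) (b i)) H (prodVec (a j) (b j))).im * C j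

end EntRate

end

/-! For a pure state, E is the entropy S(ρ_A) of the reduced state
(`relEntropyEntanglement_pureState`). A separable σ satisfies σ ≤ τ ⊗ 1 for some state τ, so
operator monotonicity of the logarithm and Klein's inequality give ⟨ψ|log σ|ψ⟩ ≤ -S(ρ_A); the state
dephased in a Schmidt basis attains equality.

The entropy is differentiated without following eigenvalues, which may cross or vanish
(`hasDerivAt_entropy`). With η(x) = -x log x, the trace of η(ρ_t) is expanded in a fixed eigenbasis
e_i of ρ_0, with eigenvalues p_i. If p_i > 0, then ⟨e_i|η(ρ_t)|e_i⟩ differs from the tangent value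
at p_i by at most ‖(ρ_t - p_i)e_i‖²/p_i = O(t²). If p_i = 0, it lies between 0 and O(t² |log t|).
Conservation of the trace removes the constant part of η', leaving a sum of log p_i times imaginary
parts of matrix elements of H.

Those imaginary parts do not change when H is replaced by H - ⟨H⟩, and ‖(H - ⟨H⟩)ψ‖² is the
variance. Bessel's inequality then bounds ∑ k_i², while Cauchy–Schwarz with the boundedness of x log
x on [0,1] bounds the rate. Unboundedness at fixed mean energy comes from scaling a coupling between
two Schmidt vectors that has zero expectation in ψ. -/

open scoped Matrix Kronecker ComplexOrder

noncomputable section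

namespace EntRate

/-! ### Spectral calculus for Hermitian matrices -/

section Spectral

variable {n : Type*} [Fintype n] [DecidableEq n]

lemma toEuclideanLin_cfc_eigenvectorBasis {M : Matrix n n ℂ} (hM : M.IsHermitian) (f : ℝ → ℝ)
    (j : n) :
    Matrix.toEuclideanLin (cfc f M) (hM.eigenvectorBasis j) =
      (f (hM.eigenvalues j) : ℂ) • hM.eigenvectorBasis j := by
  rw [hM.cfc_eq, Matrix.IsHermitian.cfc, Unitary.conjStarAlgAut_apply]
  apply WithLp.ofLp_injective
  rw [Matrix.ofLp_toLpLin, Matrix.toLin'_apply, ← Matrix.mulVec_mulVec, ← Matrix.mulVec_mulVec]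
  have h := hM.star_eigenvectorUnitary_mulVec j
  erw [h]
  rw [Matrix.diagonal_mulVec_single, mul_one,
    show (Pi.single j ((RCLike.ofReal ∘ f ∘ hM.eigenvalues) j : ℂ) : n → ℂ)
      = (f (hM.eigenvalues j) : ℂ) • Pi.single j 1 by
        rw [← Pi.single_smul]; simp, Matrix.mulVec_smul, hM.eigenvectorUnitary_mulVec]
  rfl

lemma toEuclideanLin_eigenvectorBasis {M : Matrix n n ℂ} (hM : M.IsHermitian) (j : n) :
    Matrix.toEuclideanLin M (hM.eigenvectorBasis j) =
      (hM.eigenvalues j : ℂ) • hM.eigenvectorBasis j := by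
  have h := toEuclideanLin_cfc_eigenvectorBasis hM id j
  rwa [cfc_id ℝ M hM.isSelfAdjoint] at h

lemma isHermitian_cfc (f : ℝ → ℝ) (M : Matrix n n ℂ) : (cfc f M).IsHermitian :=
  cfc_predicate (R := ℝ) f M

lemma matElem_swap {H : Matrix n n ℂ} (hH : H.IsHermitian) (φ ψ : EuclideanSpace ℂ n) :
    matElem φ H ψ = inner ℂ (Matrix.toEuclideanLin H φ) ψ :=
  ((Matrix.isSymmetric_toEuclideanLin_iff.2 hH) φ ψ).symm

/-- The expectation of `f(M)` in `v` as a sum over the spectral distribution of `v`. -/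
lemma meanEnergy_cfc {M : Matrix n n ℂ} (hM : M.IsHermitian) (f : ℝ → ℝ)
    (v : EuclideanSpace ℂ n) :
    meanEnergy v (cfc f M) =
      ∑ j, ‖inner ℂ (hM.eigenvectorBasis j) v‖ ^ 2 * f (hM.eigenvalues j) := by
  rw [meanEnergy, matElem, ← hM.eigenvectorBasis.sum_inner_mul_inner, Complex.re_sum]
  refine Finset.sum_congr rfl fun j _ => ?_
  have h := matElem_swap (isHermitian_cfc f M) (hM.eigenvectorBasis j) v
  rw [matElem, toEuclideanLin_cfc_eigenvectorBasis hM f j, inner_smul_left] at h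
  rw [h, ← inner_conj_symm v, mul_left_comm, Complex.conj_ofReal, ← Complex.normSq_eq_conj_mul_self,
    ← Complex.ofReal_mul, Complex.ofReal_re, Complex.normSq_eq_norm_sq, mul_comm]

/-- By symmetry of `M`, `v` has components only along basis vectors whose eigenvalue is `l`. This
frees later arguments from the chosen `eigenvectorBasis`, so that Schmidt bases can be used. -/
lemma toEuclideanLin_cfc_of_eigenvector {M : Matrix n n ℂ} (hM : M.IsHermitian) (f : ℝ → ℝ)
    {v : EuclideanSpace ℂ n} {l : ℝ} (hv : Matrix.toEuclideanLin M v = (l : ℂ) • v) :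
    Matrix.toEuclideanLin (cfc f M) v = (f l : ℂ) • v := by
  refine InnerProductSpace.ext_inner_left_basis (𝕜 := ℂ) hM.eigenvectorBasis.toBasis fun j => ?_
  rw [OrthonormalBasis.coe_toBasis]
  have hid := matElem_swap hM (hM.eigenvectorBasis j) v
  rw [matElem, toEuclideanLin_eigenvectorBasis hM, hv, inner_smul_left, inner_smul_right,
    Complex.conj_ofReal] at hid
  have hf := matElem_swap (isHermitian_cfc f M) (hM.eigenvectorBasis j) v
  rw [matElem, toEuclideanLin_cfc_eigenvectorBasis hM, inner_smul_left, Complex.conj_ofReal] at hf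
  rw [hf, inner_smul_right]
  by_cases h0 : inner ℂ (hM.eigenvectorBasis j) v = 0
  · simp [h0]
  · rw [Complex.ofReal_injective (mul_right_cancel₀ h0 hid)]

lemma meanEnergy_eq_sum {M : Matrix n n ℂ} (hM : M.IsHermitian) (v : EuclideanSpace ℂ n) :
    meanEnergy v M =
      ∑ j, ‖inner ℂ (hM.eigenvectorBasis j) v‖ ^ 2 * hM.eigenvalues j := by
  have h := meanEnergy_cfc hM id v
  rwa [cfc_id ℝ M hM.isSelfAdjoint] at h

lemma norm_sq_eq_sum {M : Matrix n n ℂ} (hM : M.IsHermitian) (v : EuclideanSpace ℂ n) :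
    ‖v‖ ^ 2 = ∑ j, ‖inner ℂ (hM.eigenvectorBasis j) v‖ ^ 2 :=
  (hM.eigenvectorBasis.sum_sq_norm_inner_right v).symm

/-- The second moment about `p` of the spectral distribution of `v`. It serves both as the error in
the tangent estimate and as the energy variance. -/
lemma norm_sub_sq_eq_sum {M : Matrix n n ℂ} (hM : M.IsHermitian) (p : ℝ)
    (v : EuclideanSpace ℂ n) :
    ‖Matrix.toEuclideanLin M v - (p : ℂ) • v‖ ^ 2 =
      ∑ j, ‖inner ℂ (hM.eigenvectorBasis j) v‖ ^ 2 * (hM.eigenvalues j - p) ^ 2 := by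
  rw [norm_sq_eq_sum hM]
  refine Finset.sum_congr rfl fun j _ => ?_
  have h := matElem_swap hM (hM.eigenvectorBasis j) v
  rw [matElem, toEuclideanLin_eigenvectorBasis hM, inner_smul_left, Complex.conj_ofReal] at h
  rw [inner_sub_right, h, inner_smul_right, ← sub_mul, norm_mul, ← Complex.ofReal_sub,
    Complex.norm_real, mul_pow, Real.norm_eq_abs, sq_abs, mul_comm]

lemma trace_re_eq_sum {ι : Type*} [Fintype ι] (e : OrthonormalBasis ι ℂ (EuclideanSpace ℂ n))
    (M : Matrix n n ℂ) : M.trace.re = ∑ i, meanEnergy (e i) M := by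
  have h := LinearMap.trace_eq_sum_inner (Matrix.toEuclideanLin M) e
  have h2 : LinearMap.trace ℂ _ (Matrix.toEuclideanLin M) = M.trace := by
    rw [Matrix.toEuclideanLin_eq_toLin_orthonormal, Matrix.trace_toLin_eq]
  rw [← h2, h, Complex.re_sum]; rfl

end Spectral

/-! ### Pure states, expectations and entropy -/

section Pure

variable {n : Type*} [Fintype n] [DecidableEq n]

lemma toEuclideanLin_pureState (φ ψ : EuclideanSpace ℂ n) :
    Matrix.toEuclideanLin (pureState φ) ψ = inner ℂ φ ψ • φ := by
  ext x
  simp only [Matrix.toLpLin_apply, Matrix.mulVec, dotProduct, pureState, Matrix.of_apply,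
    PiLp.smul_apply, smul_eq_mul, PiLp.inner_apply, RCLike.inner_apply, Finset.sum_mul]
  refine Finset.sum_congr rfl fun y _ => ?_
  simp only [RCLike.star_def]
  ring

omit [Fintype n] [DecidableEq n] in
lemma pureState_eq_vecMulVec (ψ : EuclideanSpace ℂ n) :
    pureState ψ = Matrix.vecMulVec (ψ : n → ℂ) (star (ψ : n → ℂ)) := rfl

omit [DecidableEq n] in
lemma posSemidef_pureState (ψ : EuclideanSpace ℂ n) : (pureState ψ).PosSemidef := by
  rw [pureState_eq_vecMulVec]
  exact Matrix.posSemidef_vecMulVec_self_star _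

lemma trace_pureState_mul (ψ : EuclideanSpace ℂ n) (M : Matrix n n ℂ) :
    (pureState ψ * M).trace = matElem ψ M ψ := by
  rw [pureState_eq_vecMulVec, Matrix.trace_mul_comm, Matrix.mul_vecMulVec,
    Matrix.trace_vecMulVec, matElem, EuclideanSpace.inner_eq_star_dotProduct]
  rfl

lemma isDensity_pureState {ψ : EuclideanSpace ℂ n} (h : ‖ψ‖ = 1) : IsDensity (pureState ψ) := by
  refine ⟨posSemidef_pureState ψ, ?_⟩
  have h1 := trace_pureState_mul ψ 1
  rw [mul_one] at h1
  rw [h1, matElem, Matrix.toLpLin_one, LinearMap.id_apply, inner_self_eq_norm_sq_to_K, h]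
  simp

lemma meanEnergy_sub (v : EuclideanSpace ℂ n) (X Y : Matrix n n ℂ) :
    meanEnergy v (X - Y) = meanEnergy v X - meanEnergy v Y := by
  simp [meanEnergy, matElem]

lemma meanEnergy_one (v : EuclideanSpace ℂ n) :
    meanEnergy v (1 : Matrix n n ℂ) = ‖v‖ ^ 2 := by
  rw [meanEnergy, matElem, Matrix.toLpLin_one, LinearMap.id_apply,
    inner_self_eq_norm_sq_to_K]
  norm_cast

lemma meanEnergy_nonneg {M : Matrix n n ℂ} (hM : M.PosSemidef) (v : EuclideanSpace ℂ n) :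
    0 ≤ meanEnergy v M := by
  rw [meanEnergy_eq_sum hM.1]
  exact Finset.sum_nonneg fun j _ => mul_nonneg (sq_nonneg _) (hM.eigenvalues_nonneg j)

lemma meanEnergy_mono {X Y : Matrix n n ℂ} (h : (Y - X).PosSemidef) (v : EuclideanSpace ℂ n) :
    meanEnergy v X ≤ meanEnergy v Y := by
  have := meanEnergy_nonneg h v
  rw [meanEnergy_sub] at this
  linarith

/-- The von Neumann entropy. -/
def entropy (M : Matrix n n ℂ) : ℝ := (cfc Real.negMulLog M).trace.re

lemma meanEnergy_cfc_of_eigenvector {M : Matrix n n ℂ} (hM : M.IsHermitian) (f : ℝ → ℝ)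
    {v : EuclideanSpace ℂ n} {l : ℝ} (hv : Matrix.toEuclideanLin M v = (l : ℂ) • v) :
    meanEnergy v (cfc f M) = f l * ‖v‖ ^ 2 := by
  rw [meanEnergy, matElem, toEuclideanLin_cfc_of_eigenvector hM f hv, inner_smul_right,
    inner_self_eq_norm_sq_to_K]
  norm_cast
  exact Complex.re_ofReal_mul _ _

lemma entropy_eq_sum {ι : Type*} [Fintype ι] {M : Matrix n n ℂ} (hM : M.IsHermitian)
    (e : OrthonormalBasis ι ℂ (EuclideanSpace ℂ n)) {p : ι → ℝ}
    (he : ∀ i, Matrix.toEuclideanLin M (e i) = (p i : ℂ) • e i) :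
    entropy M = ∑ i, Real.negMulLog (p i) := by
  rw [entropy, trace_re_eq_sum e]
  refine Finset.sum_congr rfl fun i _ => ?_
  rw [meanEnergy_cfc_of_eigenvector hM _ (he i), e.norm_eq_one]
  simp

end Pure

/-! ### Partial inner products and the reduced state -/

section Bipartite

variable {dA dB : ℕ}

lemma inner_prodVec (a a' : EuclideanSpace ℂ (Fin dA)) (b b' : EuclideanSpace ℂ (Fin dB)) :
    inner ℂ (prodVec a b) (prodVec a' b') = inner ℂ a a' * inner ℂ b b' := by
  simp only [PiLp.inner_apply, RCLike.inner_apply, prodVec, Fintype.sum_prod_type,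
    Finset.sum_mul_sum, map_mul]
  refine Finset.sum_congr rfl fun x _ => Finset.sum_congr rfl fun y _ => ?_
  ring

lemma norm_prodVec (a : EuclideanSpace ℂ (Fin dA)) (b : EuclideanSpace ℂ (Fin dB)) :
    ‖prodVec a b‖ = ‖a‖ * ‖b‖ := by
  have h := inner_prodVec a a b b
  simp only [inner_self_eq_norm_sq_to_K] at h
  norm_cast at h
  rw [← mul_pow] at h
  exact (sq_eq_sq₀ (by positivity) (by positivity)).1 h

lemma pureState_prodVec (a : EuclideanSpace ℂ (Fin dA)) (b : EuclideanSpace ℂ (Fin dB)) :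
    pureState (prodVec a b) = pureState a ⊗ₖ pureState b := by
  ext x y
  simp only [pureState, prodVec, Matrix.of_apply, Matrix.kroneckerMap_apply, star_mul']
  ring

lemma prodVec_smul_right (c : ℂ) (a : EuclideanSpace ℂ (Fin dA)) (b : EuclideanSpace ℂ (Fin dB)) :
    prodVec a (c • b) = c • prodVec a b := by
  ext x
  simp only [prodVec, PiLp.smul_apply, smul_eq_mul]
  ring

/-- The partial inner product `(⟨e| ⊗ 1) ψ`. -/
def slice (e : EuclideanSpace ℂ (Fin dA)) (ψ : BiVec dA dB) : EuclideanSpace ℂ (Fin dB) :=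
  WithLp.toLp 2 fun y => ∑ x, star (e x) * ψ (x, y)

/-- The reduced state of the first system. -/
def reducedA (ψ : BiVec dA dB) : Matrix (Fin dA) (Fin dA) ℂ :=
  Matrix.of fun x x' => ∑ y, ψ (x, y) * star (ψ (x', y))

lemma posSemidef_reducedA (ψ : BiVec dA dB) : (reducedA ψ).PosSemidef := by
  have h : reducedA ψ = (Matrix.of fun x y => ψ (x, y)) * (Matrix.of fun x y => ψ (x, y))ᴴ := by
    ext x x'
    simp [reducedA, Matrix.mul_apply]
  rw [h]
  exact Matrix.posSemidef_self_mul_conjTranspose _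

lemma inner_prodVec_left (a : EuclideanSpace ℂ (Fin dA)) (b : EuclideanSpace ℂ (Fin dB))
    (ψ : BiVec dA dB) : inner ℂ (prodVec a b) ψ = inner ℂ b (slice a ψ) := by
  simp only [PiLp.inner_apply, RCLike.inner_apply, prodVec, slice, Fintype.sum_prod_type_right,
    map_mul, Finset.sum_mul]
  refine Finset.sum_congr rfl fun x _ => Finset.sum_congr rfl fun y _ => ?_
  simp only [RCLike.star_def]
  ring

/-- Slices along an orthonormal eigenbasis of the reduced state are therefore orthogonal, with the
eigenvalues as squared norms: this is the Schmidt decomposition. -/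
lemma inner_slice_slice (e e' : EuclideanSpace ℂ (Fin dA)) (ψ : BiVec dA dB) :
    inner ℂ (slice e ψ) (slice e' ψ) = matElem e' (reducedA ψ) e := by
  simp only [matElem, PiLp.inner_apply, RCLike.inner_apply, slice, reducedA,
    Matrix.toLpLin_apply, Matrix.mulVec, dotProduct, Matrix.of_apply, map_sum, map_mul,
    Finset.sum_mul, Finset.mul_sum, RCLike.star_def, Complex.conj_conj]
  conv_rhs => rw [Finset.sum_comm]
  rw [Finset.sum_comm]
  refine Finset.sum_congr rfl fun x _ => ?_
  rw [Finset.sum_comm]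
  refine Finset.sum_congr rfl fun x' _ => Finset.sum_congr rfl fun y _ => ?_
  ring

lemma norm_slice_sq (e : EuclideanSpace ℂ (Fin dA)) (ψ : BiVec dA dB) :
    ‖slice e ψ‖ ^ 2 = meanEnergy e (reducedA ψ) := by
  rw [meanEnergy, ← inner_slice_slice, inner_self_eq_norm_sq_to_K]
  norm_cast

lemma sum_prodVec_slice {ι : Type*} [Fintype ι]
    (e : OrthonormalBasis ι ℂ (EuclideanSpace ℂ (Fin dA))) (ψ : BiVec dA dB) :
    ∑ i, prodVec (e i) (slice (e i) ψ) = ψ := by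
  ext ⟨x, y⟩
  have h := congrArg (fun v : EuclideanSpace ℂ (Fin dA) => v x)
    (e.sum_repr' (WithLp.toLp 2 fun x => ψ (x, y)))
  simp only [WithLp.ofLp_sum, Finset.sum_apply, PiLp.smul_apply, smul_eq_mul,
    PiLp.inner_apply, RCLike.inner_apply] at h
  rw [← h]
  simp only [WithLp.ofLp_sum, Finset.sum_apply, prodVec, slice, RCLike.star_def]
  refine Finset.sum_congr rfl fun i _ => ?_
  rw [mul_comm]
  congr 1
  exact Finset.sum_congr rfl fun _ _ => mul_comm _ _

lemma trace_reducedA (ψ : BiVec dA dB) : (reducedA ψ).trace.re = ‖ψ‖ ^ 2 := by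
  rw [EuclideanSpace.norm_sq_eq, Fintype.sum_prod_type, Matrix.trace, Complex.re_sum]
  refine Finset.sum_congr rfl fun x _ => ?_
  simp only [Matrix.diag_apply, reducedA, Matrix.of_apply, Complex.re_sum]
  refine Finset.sum_congr rfl fun y _ => ?_
  rw [RCLike.star_def, Complex.mul_conj, Complex.ofReal_re, Complex.normSq_eq_norm_sq]

end Bipartite

/-! ### Monotonicity of the logarithm -/

section LogMonotone

variable {n : Type*} [Fintype n] [DecidableEq n]

open scoped MatrixOrder Matrix.Norms.L2Operator in
lemma posSemidef_cfc_log_sub {X Y : Matrix n n ℂ} (hX : X.PosDef) (hXY : (Y - X).PosSemidef) :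
    (cfc Real.log Y - cfc Real.log X).PosSemidef :=
  Matrix.le_iff.1 (CFC.log_le_log (a := X) (b := Y) (Matrix.le_iff.2 hXY)
    (Matrix.isStrictlyPositive_iff_posDef.2 hX))

lemma cfc_add_smul_one {M : Matrix n n ℂ} (hM : M.IsHermitian) (f : ℝ → ℝ) (r : ℝ) :
    cfc f (M + (r : ℂ) • (1 : Matrix n n ℂ)) = cfc (fun x => f (x + r)) M := by
  apply Matrix.toEuclideanLin.injective
  refine hM.eigenvectorBasis.toBasis.ext fun j => ?_
  rw [OrthonormalBasis.coe_toBasis, toEuclideanLin_cfc_eigenvectorBasis hM]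
  have hr : ((r : ℂ) • (1 : Matrix n n ℂ)).IsHermitian := by
    rw [Matrix.IsHermitian, Matrix.conjTranspose_smul, Matrix.conjTranspose_one]
    simp
  refine toEuclideanLin_cfc_of_eigenvector (hM.add hr) f ?_
  rw [map_add, map_smul, LinearMap.add_apply, LinearMap.smul_apply,
    toEuclideanLin_eigenvectorBasis hM, Matrix.toLpLin_one, LinearMap.id_apply, ← add_smul,
    Complex.ofReal_add]

/-- The convention log 0 = 0 would break monotonicity on the kernel of `σ`; the support condition
gives those eigenvectors weight zero. -/
lemma meanEnergy_cfc_log_le {σ : Matrix n n ℂ} (hσ : σ.PosSemidef) {ψ : EuclideanSpace ℂ n}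
    (hsupp : ∀ v : EuclideanSpace ℂ n, Matrix.toEuclideanLin σ v = 0 → inner ℂ v ψ = 0)
    {ε : ℝ} (hε : 0 < ε) :
    meanEnergy ψ (cfc Real.log σ) ≤
      meanEnergy ψ (cfc Real.log (σ + (ε : ℂ) • (1 : Matrix n n ℂ))) := by
  rw [cfc_add_smul_one hσ.1, meanEnergy_cfc hσ.1, meanEnergy_cfc hσ.1]
  refine Finset.sum_le_sum fun j _ => ?_
  rcases (hσ.eigenvalues_nonneg j).eq_or_lt with h | h
  · have h' := toEuclideanLin_eigenvectorBasis hσ.1 j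
    rw [← h, Complex.ofReal_zero, zero_smul] at h'
    rw [hsupp _ h']
    simp
  · exact mul_le_mul_of_nonneg_left (Real.log_le_log h (by linarith)) (sq_nonneg _)

/-- Nonnegative eigenvalues with sum 1 are each at most 1. -/
lemma IsDensity.posSemidef_one_sub {β : Matrix n n ℂ} (hβ : IsDensity β) :
    (1 - β).PosSemidef := by
  have htr : ∑ j, hβ.1.1.eigenvalues j = 1 := by
    have h := congrArg Complex.re (hβ.2.symm.trans hβ.1.1.trace_eq_sum_eigenvalues)
    rw [Complex.re_sum] at h
    simpa using h.symm
  have hH : (1 - β).IsHermitian := Matrix.isHermitian_one.sub hβ.1.1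
  refine hH.posSemidef_iff_eigenvalues_nonneg.2 fun i => ?_
  have h := meanEnergy_cfc_of_eigenvector hH id (l := hH.eigenvalues i)
    (v := hH.eigenvectorBasis i) (toEuclideanLin_eigenvectorBasis hH i)
  rw [cfc_id ℝ _ hH.isSelfAdjoint, meanEnergy_sub, meanEnergy_one, meanEnergy_eq_sum hβ.1.1,
    norm_sq_eq_sum hβ.1.1, ← Finset.sum_sub_distrib, ← norm_sq_eq_sum,
    hH.eigenvectorBasis.norm_eq_one] at h
  simp only [id, one_pow, mul_one] at h
  rw [Pi.zero_apply, ← h]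
  refine Finset.sum_nonneg fun j _ => ?_
  rw [← mul_one_sub]
  refine mul_nonneg (sq_nonneg _) (sub_nonneg.2 ?_)
  rw [← htr]
  exact Finset.single_le_sum (fun k _ => hβ.1.eigenvalues_nonneg k) (Finset.mem_univ j)

omit [DecidableEq n] in
lemma IsDensity.convex : Convex ℝ {ρ : Matrix n n ℂ | IsDensity ρ} := by
  intro x hx y hy a b ha hb hab
  refine ⟨(hx.1.smul ha).add (hy.1.smul hb), ?_⟩
  rw [Matrix.trace_add, Matrix.trace_smul, Matrix.trace_smul, hx.2, hy.2, ← add_smul, hab,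
    one_smul]

end LogMonotone

/-! ### Lower bound for the relative entropy to separable states -/

section Bipartite

variable {dA dB : ℕ}

/-- The reduction criterion: a separable state is dominated by `τ ⊗ 1` for some state `τ`. -/
lemma exists_le_kronecker_one {σ : BiOp dA dB} (hσ : σ ∈ separableStates dA dB) :
    σ.PosSemidef ∧ ∃ τ : Matrix (Fin dA) (Fin dA) ℂ, IsDensity τ ∧
      (τ ⊗ₖ (1 : Matrix (Fin dB) (Fin dB) ℂ) - σ).PosSemidef := by
  -- The property is convex in σ, so checking it on product states suffices; there τ = α works
  -- because α ⊗ 1 - α ⊗ β = α ⊗ (1 - β).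
  let S : Set (BiOp dA dB) := {σ | σ.PosSemidef ∧ ∃ τ : Matrix (Fin dA) (Fin dA) ℂ, IsDensity τ ∧
      (τ ⊗ₖ (1 : Matrix (Fin dB) (Fin dB) ℂ) - σ).PosSemidef}
  have hconv : Convex ℝ S := by
    rintro x ⟨hx, τ, hτ, hxτ⟩ y ⟨hy, τ', hτ', hyτ⟩ a b ha hb hab
    refine ⟨(hx.smul ha).add (hy.smul hb), a • τ + b • τ', IsDensity.convex hτ hτ' ha hb hab, ?_⟩
    have h : (a • τ + b • τ') ⊗ₖ (1 : Matrix (Fin dB) (Fin dB) ℂ) - (a • x + b • y) =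
        a • (τ ⊗ₖ (1 : Matrix (Fin dB) (Fin dB) ℂ) - x) +
          b • (τ' ⊗ₖ (1 : Matrix (Fin dB) (Fin dB) ℂ) - y) := by
      rw [Matrix.add_kronecker, Matrix.smul_kronecker, Matrix.smul_kronecker]
      module
    rw [h]
    exact (hxτ.smul ha).add (hyτ.smul hb)
  refine convexHull_min (s := _) (t := S) ?_ hconv hσ
  rintro _ ⟨α, β, hα, hβ, rfl⟩
  refine ⟨hα.1.kronecker hβ.1, α, hα, ?_⟩
  have h : α ⊗ₖ (1 : Matrix (Fin dB) (Fin dB) ℂ) - α ⊗ₖ β = α ⊗ₖ (1 - β) := by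
    rw [sub_eq_iff_eq_add, ← Matrix.kronecker_add, sub_add_cancel]
  rw [h]
  exact hα.1.kronecker hβ.posSemidef_one_sub

lemma toEuclideanLin_kronecker_one (T : Matrix (Fin dA) (Fin dA) ℂ)
    (a : EuclideanSpace ℂ (Fin dA)) (b : EuclideanSpace ℂ (Fin dB)) :
    Matrix.toEuclideanLin (T ⊗ₖ (1 : Matrix (Fin dB) (Fin dB) ℂ)) (prodVec a b) =
      prodVec (Matrix.toEuclideanLin T a) b := by
  ext ⟨x, y⟩
  simp only [prodVec, Matrix.toLpLin_apply, Matrix.mulVec, dotProduct, Fintype.sum_prod_type,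
    Matrix.kroneckerMap_apply, Matrix.one_apply, Finset.sum_mul]
  refine Finset.sum_congr rfl fun x' _ => ?_
  simp [mul_assoc]

/-- The scalar Klein inequality: log x ≤ x - 1 at x = t/p. -/
lemma mul_log_le {p t : ℝ} (hp : 0 ≤ p) (ht : 0 < t) :
    p * Real.log t ≤ -Real.negMulLog p - p + t := by
  rcases hp.eq_or_lt with rfl | hp
  · simpa using ht.le
  · have h := mul_le_mul_of_nonneg_left (Real.log_le_sub_one_of_pos (div_pos ht hp)) hp.le
    rw [Real.log_div ht.ne' hp.ne', mul_sub, mul_sub, mul_div_cancel₀ _ hp.ne'] at h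
    rw [Real.negMulLog]
    linarith

/-- Klein's inequality for the reduced state. -/
lemma meanEnergy_cfc_log_kronecker_one_le {ψ : BiVec dA dB} (hψ : ‖ψ‖ = 1)
    {T : Matrix (Fin dA) (Fin dA) ℂ} (hT : T.PosDef) :
    meanEnergy ψ (cfc Real.log (T ⊗ₖ (1 : Matrix (Fin dB) (Fin dB) ℂ))) ≤
      -entropy (reducedA ψ) - 1 + T.trace.re := by
  set f := hT.1.eigenvectorBasis
  set t := hT.1.eigenvalues
  have hTf (j) : Matrix.toEuclideanLin T (f j) = (t j : ℂ) • f j :=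
    toEuclideanLin_eigenvectorBasis hT.1 j
  have hH : (T ⊗ₖ (1 : Matrix (Fin dB) (Fin dB) ℂ)).IsHermitian :=
    (hT.posSemidef.kronecker Matrix.PosSemidef.one).1
  have hlog (j) : Matrix.toEuclideanLin (cfc Real.log (T ⊗ₖ (1 : Matrix (Fin dB) (Fin dB) ℂ)))
      (prodVec (f j) (slice (f j) ψ)) =
        (Real.log (t j) : ℂ) • prodVec (f j) (slice (f j) ψ) := by
    refine toEuclideanLin_cfc_of_eigenvector hH _ ?_
    rw [toEuclideanLin_kronecker_one, hTf]
    ext x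
    simp only [prodVec, PiLp.smul_apply, smul_eq_mul]
    ring
  have hleft : meanEnergy ψ (cfc Real.log (T ⊗ₖ (1 : Matrix (Fin dB) (Fin dB) ℂ))) =
      ∑ j, Real.log (t j) * meanEnergy (f j) (reducedA ψ) := by
    rw [meanEnergy, matElem]
    conv_lhs =>
      arg 1; arg 3; rw [← sum_prodVec_slice f ψ]
    rw [map_sum, inner_sum, Complex.re_sum]
    refine Finset.sum_congr rfl fun j _ => ?_
    rw [hlog, inner_smul_right, ← inner_conj_symm, inner_prodVec_left,
      inner_self_eq_norm_sq_to_K, Complex.re_ofReal_mul, ← norm_slice_sq]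
    norm_cast
  have hρ := posSemidef_reducedA ψ
  set e := hρ.1.eigenvectorBasis
  set p := hρ.1.eigenvalues
  have hρe (j) : Matrix.toEuclideanLin (reducedA ψ) (e j) = (p j : ℂ) • e j :=
    toEuclideanLin_eigenvectorBasis hρ.1 j
  -- The squared overlaps of the two eigenbases form a doubly stochastic matrix, which reduces the
  -- claim to averaging the scalar inequality.
  have hw1 (j) : ∑ i, ‖inner ℂ (e i) (f j)‖ ^ 2 = 1 := by
    rw [e.sum_sq_norm_inner_right, f.norm_eq_one, one_pow]
  have hw2 (i) : ∑ j, ‖inner ℂ (e i) (f j)‖ ^ 2 = 1 := by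
    rw [f.sum_sq_norm_inner_left, e.norm_eq_one, one_pow]
  have hp1 : ∑ i, p i = 1 := by
    have h := trace_reducedA ψ
    rw [hψ, hρ.1.trace_eq_sum_eigenvalues, Complex.re_sum] at h
    simpa using h
  have ht1 : T.trace.re = ∑ j, t j := by
    rw [hT.1.trace_eq_sum_eigenvalues, Complex.re_sum]
    rfl
  rw [hleft, entropy_eq_sum hρ.1 e hρe, ht1]
  calc ∑ j, Real.log (t j) * meanEnergy (f j) (reducedA ψ)
      = ∑ j, ∑ i, ‖inner ℂ (e i) (f j)‖ ^ 2 * (p i * Real.log (t j)) := by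
        refine Finset.sum_congr rfl fun j _ => ?_
        rw [meanEnergy_eq_sum hρ.1, Finset.mul_sum]
        exact Finset.sum_congr rfl fun i _ => by ring
    _ ≤ ∑ j, ∑ i, ‖inner ℂ (e i) (f j)‖ ^ 2 * (-Real.negMulLog (p i) - p i + t j) :=
        Finset.sum_le_sum fun j _ => Finset.sum_le_sum fun i _ =>
          mul_le_mul_of_nonneg_left (mul_log_le (hρ.eigenvalues_nonneg i)
            (hT.eigenvalues_pos j)) (sq_nonneg _)
    _ = ∑ i, (-Real.negMulLog (p i) - p i) + ∑ j, t j := by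
        simp only [mul_add, Finset.sum_add_distrib]
        rw [Finset.sum_comm]
        simp only [← Finset.sum_mul, hw1, hw2, one_mul]
    _ = _ := by rw [Finset.sum_sub_distrib, hp1, Finset.sum_neg_distrib]

lemma meanEnergy_cfc_log_separable_le {ψ : BiVec dA dB} (hψ : ‖ψ‖ = 1) {σ : BiOp dA dB}
    (hσ : σ ∈ separableStates dA dB)
    (hsupp : ∀ v : BiVec dA dB, Matrix.toEuclideanLin σ v = 0 → inner ℂ v ψ = 0) :
    meanEnergy ψ (cfc Real.log σ) ≤ -entropy (reducedA ψ) := by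
  obtain ⟨hpos, τ, hτ, hle⟩ := exists_le_kronecker_one hσ
  -- τ and σ may be singular. Adding ε to both makes them positive definite without changing τ ⊗ 1 -
  -- σ, at the price of ε · dA in the trace of τ.
  have key (ε : ℝ) (hε : 0 < ε) :
      meanEnergy ψ (cfc Real.log σ) ≤ -entropy (reducedA ψ) + ε * dA := by
    have hε' : (0 : ℂ) < (ε : ℂ) := by exact_mod_cast hε
    have hT : (τ + (ε : ℂ) • (1 : Matrix (Fin dA) (Fin dA) ℂ)).PosDef :=
      Matrix.PosDef.posSemidef_add hτ.1 (Matrix.PosDef.one.smul hε')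
    have hσε : (σ + (ε : ℂ) • (1 : BiOp dA dB)).PosDef :=
      Matrix.PosDef.posSemidef_add hpos (Matrix.PosDef.one.smul hε')
    have hle' : ((τ + (ε : ℂ) • (1 : Matrix (Fin dA) (Fin dA) ℂ)) ⊗ₖ
        (1 : Matrix (Fin dB) (Fin dB) ℂ) - (σ + (ε : ℂ) • (1 : BiOp dA dB))).PosSemidef := by
      rwa [Matrix.add_kronecker, Matrix.smul_kronecker, Matrix.one_kronecker_one,
        add_sub_add_right_eq_sub]
    have h1 := meanEnergy_cfc_log_le hpos hsupp hε
    have h2 := meanEnergy_mono (posSemidef_cfc_log_sub hσε hle') ψ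
    have h3 := meanEnergy_cfc_log_kronecker_one_le hψ hT
    have h4 : (τ + (ε : ℂ) • (1 : Matrix (Fin dA) (Fin dA) ℂ)).trace.re = 1 + ε * dA := by
      rw [Matrix.trace_add, Matrix.trace_smul, Matrix.trace_one, hτ.2]
      simp
    linarith
  have hlim : Filter.Tendsto (fun ε : ℝ => -entropy (reducedA ψ) + ε * dA)
      (nhdsWithin 0 (Set.Ioi 0)) (nhds (-entropy (reducedA ψ) + 0 * dA)) :=
    (Continuous.tendsto (by fun_prop) 0).mono_left nhdsWithin_le_nhds
  rw [zero_mul, add_zero] at hlim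
  refine ge_of_tendsto hlim ?_
  filter_upwards [self_mem_nhdsWithin] with ε hε using key ε hε

end Bipartite

/-! ### Relative entropy with a pure first argument -/

section RelEntropy

variable {n : Type*} [Fintype n] [DecidableEq n]

lemma relEntropy_pureState {ψ : EuclideanSpace ℂ n} (hψ : ‖ψ‖ = 1) {σ : Matrix n n ℂ}
    (hsupp : ∀ v : EuclideanSpace ℂ n, Matrix.toEuclideanLin σ v = 0 → inner ℂ v ψ = 0) :
    relEntropy (pureState ψ) σ = ((-meanEnergy ψ (cfc Real.log σ) : ℝ) : EReal) := by
  rw [relEntropy, if_pos]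
  · rw [trace_pureState_mul]
    change ((meanEnergy ψ (cfc Real.log (pureState ψ) - cfc Real.log σ) : ℝ) : EReal) = _
    have h1 : Matrix.toEuclideanLin (pureState ψ) ψ = ((1 : ℝ) : ℂ) • ψ := by
      rw [toEuclideanLin_pureState, inner_self_eq_norm_sq_to_K, hψ]
      simp
    rw [meanEnergy_sub, meanEnergy_cfc_of_eigenvector (posSemidef_pureState ψ).1 _ h1,
      Real.log_one, zero_mul, zero_sub]
  · intro v hv
    have h := hsupp (WithLp.toLp 2 v) (by rw [Matrix.toLpLin_apply, hv]; rfl)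
    have h2 := toEuclideanLin_pureState ψ (WithLp.toLp 2 v)
    rw [← inner_conj_symm, h, map_zero, zero_smul] at h2
    exact congrArg WithLp.ofLp h2

lemma relEntropy_pureState_eq_top {ψ : EuclideanSpace ℂ n} {σ : Matrix n n ℂ}
    (hsupp : ¬ ∀ v : EuclideanSpace ℂ n, Matrix.toEuclideanLin σ v = 0 → inner ℂ v ψ = 0) :
    relEntropy (pureState ψ) σ = ⊤ := by
  rw [relEntropy, if_neg]
  contrapose! hsupp
  intro v hv
  have h := hsupp v (congrArg WithLp.ofLp hv)
  have h2 : Matrix.toEuclideanLin (pureState ψ) v = 0 := by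
    rw [Matrix.toLpLin_apply, h]; rfl
  rw [toEuclideanLin_pureState] at h2
  rcases smul_eq_zero.1 h2 with h2 | h2
  · rw [← inner_conj_symm, h2, map_zero]
  · rw [h2, inner_zero_right]

end RelEntropy

/-! ### Entanglement of a pure state equals its reduced entropy -/

section Bipartite

variable {dA dB : ℕ}

lemma exists_unit_smul_eq {m : ℕ} (hm : 0 < m) (g : EuclideanSpace ℂ (Fin m)) :
    ∃ v : EuclideanSpace ℂ (Fin m), ‖v‖ = 1 ∧ g = (‖g‖ : ℂ) • v := by
  by_cases hg : g = 0
  · exact ⟨EuclideanSpace.single ⟨0, hm⟩ 1, by simp, by simp [hg]⟩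
  · have h0 : ‖g‖ ≠ 0 := norm_ne_zero_iff.2 hg
    refine ⟨((‖g‖⁻¹ : ℝ) : ℂ) • g, ?_, ?_⟩
    · rw [norm_smul, Complex.norm_real, norm_inv, norm_norm, inv_mul_cancel₀ h0]
    · rw [smul_smul, ← Complex.ofReal_mul, mul_inv_cancel₀ h0, Complex.ofReal_one, one_smul]

/-- The state obtained by dephasing `ψ` in its Schmidt basis attains the entropy. -/
lemma exists_separable_relEntropy_eq {ψ : BiVec dA dB} (hψ : ‖ψ‖ = 1) :
    ∃ σ ∈ separableStates dA dB,
      relEntropy (pureState ψ) σ = (entropy (reducedA ψ) : EReal) := by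
  have hdB : 0 < dB := by
    rcases Nat.eq_zero_or_pos dB with rfl | h
    · have : ψ = 0 := by ext ⟨_, y⟩; exact y.elim0
      simp [this] at hψ
    · exact h
  have hρ := posSemidef_reducedA ψ
  set e := hρ.1.eigenvectorBasis
  set p := hρ.1.eigenvalues
  have hρe (j) : Matrix.toEuclideanLin (reducedA ψ) (e j) = (p j : ℂ) • e j :=
    toEuclideanLin_eigenvectorBasis hρ.1 j
  have hp0 (j) : 0 ≤ p j := hρ.eigenvalues_nonneg j
  have hp1 : ∑ i, p i = 1 := by
    have h := trace_reducedA ψ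
    rw [hψ, hρ.1.trace_eq_sum_eigenvalues, Complex.re_sum] at h
    simpa using h
  -- A vanishing slice still receives a unit vector, so that every product state entering σ is a
  -- density matrix.
  choose v hv1 hv using fun i => exists_unit_smul_eq hdB (slice (e i) ψ)
  have hnorm (i) : ‖slice (e i) ψ‖ ^ 2 = p i := by
    rw [norm_slice_sq, meanEnergy, matElem, hρe, inner_smul_right, inner_self_eq_norm_sq_to_K,
      e.norm_eq_one]
    simp
  set u := fun i => prodVec (e i) (v i)
  have hu1 (i) : ‖u i‖ = 1 := by
    rw [norm_prodVec, hv1, e.norm_eq_one, one_mul]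
  have hu0 {i j} (hij : i ≠ j) : inner ℂ (u i) (u j) = 0 := by
    rw [inner_prodVec, e.inner_eq_zero hij, zero_mul]
  have hψu : ψ = ∑ i, (‖slice (e i) ψ‖ : ℂ) • u i := by
    conv_lhs => rw [← sum_prodVec_slice e ψ]
    refine Finset.sum_congr rfl fun i _ => ?_
    conv_lhs => rw [hv i]
    rw [prodVec_smul_right]
  have huψ (i) : inner ℂ (u i) ψ = (‖slice (e i) ψ‖ : ℂ) := by
    conv_lhs => rw [hψu]
    rw [inner_sum, Finset.sum_eq_single i, inner_smul_right, inner_self_eq_norm_sq_to_K, hu1]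
    · simp
    · intro j _ hj
      rw [inner_smul_right, hu0 hj.symm, mul_zero]
    · simp
  set σ : BiOp dA dB := ∑ i, p i • pureState (u i)
  have hσpos : σ.PosSemidef :=
    Matrix.posSemidef_sum _ fun i _ => (posSemidef_pureState (u i)).smul (hp0 i)
  have hσv (w : BiVec dA dB) :
      Matrix.toEuclideanLin σ w = ∑ i, ((p i : ℂ) * inner ℂ (u i) w) • u i := by
    rw [map_sum, LinearMap.sum_apply]
    refine Finset.sum_congr rfl fun i _ => ?_
    have h : p i • pureState (u i) = (p i : ℂ) • pureState (u i) := by ext; simp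
    rw [h, map_smul, LinearMap.smul_apply, toEuclideanLin_pureState, smul_smul]
  have hσu (i) : Matrix.toEuclideanLin σ (u i) = (p i : ℂ) • u i := by
    rw [hσv, Finset.sum_eq_single i, inner_self_eq_norm_sq_to_K, hu1]
    · simp
    · intro j _ hj
      rw [hu0 hj, mul_zero, zero_smul]
    · simp
  refine ⟨σ, ?_, ?_⟩
  · refine (convex_convexHull ℝ _).sum_mem (fun i _ => hp0 i) hp1 fun i _ => ?_
    exact subset_convexHull ℝ _ ⟨pureState (e i), pureState (v i),
      isDensity_pureState (e.norm_eq_one i), isDensity_pureState (hv1 i), pureState_prodVec _ _⟩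
  · rw [relEntropy_pureState hψ, entropy_eq_sum hρ.1 e hρe]
    · congr 1
      rw [meanEnergy, matElem]
      conv_lhs => arg 1; arg 1; arg 3; rw [hψu]
      rw [map_sum, inner_sum, Complex.re_sum, ← Finset.sum_neg_distrib]
      refine Finset.sum_congr rfl fun i _ => ?_
      rw [map_smul, toEuclideanLin_cfc_of_eigenvector hσpos.1 _ (hσu i), inner_smul_right,
        inner_smul_right, ← inner_conj_symm, huψ, Complex.conj_ofReal, ← Complex.ofReal_mul,
        ← Complex.ofReal_mul, Complex.ofReal_re, Real.negMulLog, ← hnorm i]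
      ring
    · intro w hw
      -- Either the i-th Schmidt coefficient of ψ vanishes, or the kernel vector w is orthogonal to
      -- u i.
      have h (i) : (‖slice (e i) ψ‖ : ℂ) * inner ℂ w (u i) = 0 := by
        have h2 := congrArg (inner ℂ (u i)) hw
        rw [← matElem, matElem_swap hσpos.1, hσu, inner_zero_right, inner_smul_left,
          Complex.conj_ofReal, ← hnorm i] at h2
        rcases mul_eq_zero.1 h2 with h2 | h2
        · have h3 : ‖slice (e i) ψ‖ = 0 :=
            (pow_eq_zero_iff two_ne_zero).1 (Complex.ofReal_eq_zero.1 h2)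
          rw [h3]; simp
        · rw [← inner_conj_symm, h2]; simp
      rw [hψu, inner_sum]
      exact Finset.sum_eq_zero fun i _ => by rw [inner_smul_right, h]

/-- The relative entropy of entanglement of a pure state is its entropy of entanglement. -/
theorem relEntropyEntanglement_pureState {ψ : BiVec dA dB} (hψ : ‖ψ‖ = 1) :
    relEntropyEntanglement (pureState ψ) = entropy (reducedA ψ) := by
  rw [relEntropyEntanglement]
  have h : (⨅ σ ∈ separableStates dA dB, relEntropy (pureState ψ) σ) =
      (entropy (reducedA ψ) : EReal) := by
    apply le_antisymm
    · obtain ⟨σ, hσ, h⟩ := exists_separable_relEntropy_eq hψ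
      exact h ▸ iInf₂_le σ hσ
    · refine le_iInf₂ fun σ hσ => ?_
      by_cases hsupp :
          ∀ v : BiVec dA dB, Matrix.toEuclideanLin σ v = 0 → inner ℂ v ψ = 0
      · rw [relEntropy_pureState hψ hsupp, EReal.coe_le_coe_iff]
        have := meanEnergy_cfc_log_separable_le hψ hσ hsupp
        linarith
      · rw [relEntropy_pureState_eq_top hsupp]
        exact le_top
  rw [h, EReal.toReal_coe]

end Bipartite

/-! ### Scalar estimates for -x log x and little-o bounds -/

section Scalar

open Asymptotics Filter Topology

lemma negMulLog_le_tangent {p x : ℝ} (hp : 0 < p) (hx : 0 ≤ x) :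
    Real.negMulLog x ≤ Real.negMulLog p + (-Real.log p - 1) * (x - p) := by
  have h := mul_log_le hx hp
  simp only [Real.negMulLog] at h ⊢
  linarith

/-- From log(x/p) ≤ x/p - 1. The quadratic error bound is global in `x ≥ 0`, so no continuity of the
spectrum is needed later. -/
lemma tangent_sub_le_negMulLog {p x : ℝ} (hp : 0 < p) (hx : 0 ≤ x) :
    Real.negMulLog p + (-Real.log p - 1) * (x - p) - (x - p) ^ 2 / p ≤ Real.negMulLog x := by
  have h2 : (x - p) ^ 2 / p = x * (x / p) - 2 * x + p := by field_simp; ring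
  have h1 : x * Real.log x ≤ x * Real.log p + x * (x / p) - x := by
    rcases hx.eq_or_lt with rfl | hx
    · simp
    · have h := mul_le_mul_of_nonneg_left (Real.log_le_sub_one_of_pos (div_pos hx hp)) hx.le
      rw [Real.log_div hx.ne' hp.ne'] at h
      linarith
  rw [h2]
  simp only [Real.negMulLog]
  linarith

/-- The bound is asked only for `t ≠ 0` because it is applied with t² as a strictly positive
parameter. -/
lemma hasDerivAt_of_abs_sub_le {f g h : ℝ → ℝ} {g' : ℝ} (hg : HasDerivAt g g' 0)
    (h0 : f 0 = g 0) (hfg : ∀ t, t ≠ 0 → |f t - g t| ≤ h t) (hh : h =o[𝓝 0] fun t => t) :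
    HasDerivAt f g' 0 := by
  rw [hasDerivAt_iff_isLittleO] at hg ⊢
  have h1 : (fun t => f t - g t) =o[𝓝 0] fun t : ℝ => t - 0 := by
    simp only [sub_zero]
    refine IsBigO.trans_isLittleO (IsBigO.of_norm_le fun t => ?_) hh
    by_cases ht : t = 0
    · subst ht
      have h2 : h 0 = 0 := by simpa using (hh.bound one_pos).self_of_nhds
      simp [h0, h2]
    · exact hfg t ht
  refine (h1.add hg).congr_left fun t => ?_
  rw [h0]
  ring

lemma isBigO_norm_sq_of_differentiableAt {E : Type*} [NormedAddCommGroup E] [NormedSpace ℝ E]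
    {g : ℝ → E} (hg : DifferentiableAt ℝ g 0) (h0 : g 0 = 0) :
    (fun t => ‖g t‖ ^ 2) =O[𝓝 0] fun t => t ^ 2 := by
  have h := hg.isBigO_sub
  simp only [h0, sub_zero] at h
  exact h.norm_left.pow 2

lemma isLittleO_sq : (fun t : ℝ => t ^ 2) =o[𝓝 0] fun t => t := by
  simpa using isLittleO_pow_id (𝕜 := ℝ) (one_lt_two)

lemma isLittleO_mul_log_sq {r : ℝ → ℝ} (hr : r =O[𝓝 0] fun t => t ^ 2) :
    (fun t => t ^ 2 - r t * Real.log (t ^ 2)) =o[𝓝 0] fun t => t := by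
  refine isLittleO_sq.sub ?_
  have h1 : (fun t => r t * Real.log (t ^ 2)) =O[𝓝 0] fun t => t ^ 2 * Real.log (t ^ 2) :=
    hr.mul (isBigO_refl _ _)
  refine h1.trans_isLittleO ?_
  have h2 : (fun t : ℝ => 2 * (t * Real.log t)) =o[𝓝 0] fun _ => (1 : ℝ) := by
    rw [isLittleO_one_iff]
    have h := (Real.continuous_mul_log.const_mul 2).tendsto (0 : ℝ)
    simpa using h
  have h3 := (isBigO_refl (fun t : ℝ => t) (𝓝 0)).mul_isLittleO h2
  refine (h3.congr_left fun t => ?_).congr_right fun t => mul_one t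
  rw [Real.log_pow]
  push_cast
  ring

end Scalar

/-! ### Derivative of the entropy along a curve of unit vectors -/

section Derivative

open Asymptotics Filter Topology

variable {dA dB : ℕ}

/-- The partial inner product as a continuous real-linear map of the bipartite vector. -/
def sliceCLM (e : EuclideanSpace ℂ (Fin dA)) :
    BiVec dA dB →L[ℝ] EuclideanSpace ℂ (Fin dB) :=
  LinearMap.toContinuousLinearMap
    { toFun := slice e
      map_add' := fun ψ φ => by
        ext y
        simp [slice, mul_add, Finset.sum_add_distrib]
      map_smul' := fun c ψ => by
        ext y
        simp only [slice, PiLp.smul_apply, Complex.real_smul, RingHom.id_apply, Finset.mul_sum]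
        exact Finset.sum_congr rfl fun x _ => by ring }

lemma hasDerivAt_norm_slice_sq {φ : ℝ → BiVec dA dB} {φ' : BiVec dA dB}
    (hφ : HasDerivAt φ φ' 0) (e : EuclideanSpace ℂ (Fin dA)) :
    HasDerivAt (fun t => meanEnergy e (reducedA (φ t)))
      (2 * (inner ℂ (slice e (φ 0)) (slice e φ')).re) 0 := by
  have hs : HasDerivAt (fun t => slice e (φ t)) (slice e φ') 0 :=
    (sliceCLM e).hasFDerivAt.comp_hasDerivAt 0 hφ
  have h := hs.inner ℂ hs
  have h2 := Complex.reCLM.hasFDerivAt.comp_hasDerivAt 0 h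
  have h3 : (fun t => meanEnergy e (reducedA (φ t))) =
      Complex.reCLM ∘ fun t => inner ℂ (slice e (φ t)) (slice e (φ t)) := by
    ext t
    simp only [Function.comp, Complex.reCLM_apply, inner_slice_slice]
    rfl
  rw [h3]
  refine h2.congr_deriv ?_
  rw [Complex.reCLM_apply, Complex.add_re, ← inner_conj_symm (slice e φ'), Complex.conj_re]
  ring

lemma differentiableAt_reducedA {φ : ℝ → BiVec dA dB} (hφ : DifferentiableAt ℝ φ 0)
    (e : EuclideanSpace ℂ (Fin dA)) :
    DifferentiableAt ℝ (fun t => Matrix.toEuclideanLin (reducedA (φ t)) e) 0 := by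
  have hc (z : Fin dA × Fin dB) : DifferentiableAt ℝ (fun t => φ t z) 0 :=
    ((differentiableAt_piLp 2).1 hφ) z
  refine (differentiableAt_piLp 2).2 fun x => ?_
  simp only [Matrix.toLpLin_apply, Matrix.mulVec, dotProduct, reducedA, Matrix.of_apply]
  refine DifferentiableAt.fun_sum fun x' _ => DifferentiableAt.mul_const ?_ _
  exact DifferentiableAt.fun_sum fun y _ => (hc _).mul (hc _).star

lemma meanEnergy_cfc_le_of_forall {n : Type*} [Fintype n] [DecidableEq n] {M : Matrix n n ℂ}
    (hM : M.IsHermitian) {f g : ℝ → ℝ} (v : EuclideanSpace ℂ n)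
    (h : ∀ j, f (hM.eigenvalues j) ≤ g (hM.eigenvalues j)) :
    meanEnergy v (cfc f M) ≤
      ∑ j, ‖inner ℂ (hM.eigenvectorBasis j) v‖ ^ 2 * g (hM.eigenvalues j) := by
  rw [meanEnergy_cfc hM]
  exact Finset.sum_le_sum fun j _ => mul_le_mul_of_nonneg_left (h j) (sq_nonneg _)

/-- The expectation of `-ρ log ρ` in a unit vector agrees to second order with the tangent of
`-x log x` at any positive point. -/
lemma abs_meanEnergy_cfc_negMulLog_sub_le {n : Type*} [Fintype n] [DecidableEq n]
    {M : Matrix n n ℂ} (hM : M.PosSemidef) {v : EuclideanSpace ℂ n} (hv : ‖v‖ = 1) {p : ℝ}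
    (hp : 0 < p) :
    |meanEnergy v (cfc Real.negMulLog M) -
      (Real.negMulLog p + (-Real.log p - 1) * (meanEnergy v M - p))| ≤
        ‖Matrix.toEuclideanLin M v - (p : ℂ) • v‖ ^ 2 / p := by
  have hw : ∑ j, ‖inner ℂ (hM.1.eigenvectorBasis j) v‖ ^ 2 = 1 := by
    rw [← norm_sq_eq_sum, hv, one_pow]
  have htan : Real.negMulLog p + (-Real.log p - 1) * (meanEnergy v M - p) =
      ∑ j, ‖inner ℂ (hM.1.eigenvectorBasis j) v‖ ^ 2 *
        (Real.negMulLog p + (-Real.log p - 1) * (hM.1.eigenvalues j - p)) := by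
    simp only [mul_add, mul_sub, Finset.sum_add_distrib, Finset.sum_sub_distrib, ← Finset.sum_mul,
      hw, one_mul]
    rw [meanEnergy_eq_sum hM.1, Finset.mul_sum]
    congr 2
    exact Finset.sum_congr rfl fun j _ => by ring
  rw [htan, meanEnergy_cfc hM.1, norm_sub_sq_eq_sum hM.1, Finset.sum_div,
    ← Finset.sum_sub_distrib]
  refine (Finset.abs_sum_le_sum_abs _ _).trans (Finset.sum_le_sum fun j _ => ?_)
  rw [← mul_sub, abs_mul, abs_of_nonneg (sq_nonneg _), mul_div_assoc]
  refine mul_le_mul_of_nonneg_left ?_ (sq_nonneg _)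
  have h1 := negMulLog_le_tangent hp (hM.eigenvalues_nonneg j)
  have h2 := tangent_sub_le_negMulLog hp (hM.eigenvalues_nonneg j)
  rw [abs_of_nonpos (by linarith)]
  linarith

/-- Replaces the tangent at eigenvalue 0, where -x log x has infinite slope: the line x ↦ s - x log
s lies above it for each `s > 0`, and `s` can shrink with time. -/
lemma meanEnergy_cfc_negMulLog_le {n : Type*} [Fintype n] [DecidableEq n]
    {M : Matrix n n ℂ} (hM : M.PosSemidef) {v : EuclideanSpace ℂ n} (hv : ‖v‖ = 1) {s : ℝ}
    (hs : 0 < s) :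
    meanEnergy v (cfc Real.negMulLog M) ≤ s - meanEnergy v M * Real.log s := by
  have h := meanEnergy_cfc_le_of_forall hM.1 (g := fun x => s - x * Real.log s) v
    (fun j => by
      have h1 := mul_log_le (hM.eigenvalues_nonneg j) hs
      have h2 := hM.eigenvalues_nonneg j
      linarith)
  refine h.trans_eq ?_
  simp only [mul_sub, Finset.sum_sub_distrib, ← Finset.sum_mul, ← mul_assoc]
  rw [← norm_sq_eq_sum, hv, ← meanEnergy_eq_sum]
  ring

lemma meanEnergy_cfc_negMulLog_nonneg {n : Type*} [Fintype n] [DecidableEq n]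
    {M : Matrix n n ℂ} (hM : M.PosSemidef) (htr : M.trace.re = 1) (v : EuclideanSpace ℂ n) :
    0 ≤ meanEnergy v (cfc Real.negMulLog M) := by
  rw [meanEnergy_cfc hM.1]
  have hsum : ∑ j, hM.1.eigenvalues j = 1 := by
    rw [hM.1.trace_eq_sum_eigenvalues, Complex.re_sum] at htr
    simpa using htr
  refine Finset.sum_nonneg fun j _ => mul_nonneg (sq_nonneg _) ?_
  refine Real.negMulLog_nonneg (hM.eigenvalues_nonneg j) ?_
  rw [← hsum]
  exact Finset.single_le_sum (fun k _ => hM.eigenvalues_nonneg k) (Finset.mem_univ j)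

lemma hasDerivAt_meanEnergy_cfc_negMulLog {φ : ℝ → BiVec dA dB} {φ' : BiVec dA dB}
    (hφ : HasDerivAt φ φ' 0) (hnorm : ∀ t, ‖φ t‖ = 1) {e : EuclideanSpace ℂ (Fin dA)}
    (he1 : ‖e‖ = 1) {p : ℝ} (hp : 0 ≤ p)
    (he : Matrix.toEuclideanLin (reducedA (φ 0)) e = (p : ℂ) • e) :
    HasDerivAt (fun t => meanEnergy e (cfc Real.negMulLog (reducedA (φ t))))
      ((-Real.log p - 1) * (2 * (inner ℂ (slice e (φ 0)) (slice e φ')).re)) 0 := by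
  have hr0 : meanEnergy e (reducedA (φ 0)) = p := by
    rw [meanEnergy, matElem, he, inner_smul_right, inner_self_eq_norm_sq_to_K, he1]
    simp
  have hm0 : meanEnergy e (cfc Real.negMulLog (reducedA (φ 0))) = Real.negMulLog p := by
    rw [meanEnergy_cfc_of_eigenvector (posSemidef_reducedA _).1 _ he, he1]
    simp
  rcases hp.eq_or_lt with rfl | hp
  · have hs0 : slice e (φ 0) = 0 := by
      rw [← norm_eq_zero, ← pow_eq_zero_iff two_ne_zero, norm_slice_sq, hr0]
    rw [hs0, inner_zero_left, Complex.zero_re, mul_zero, mul_zero]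
    have hsd : DifferentiableAt ℝ (fun t => slice e (φ t)) 0 :=
      ((sliceCLM e).hasFDerivAt.comp_hasDerivAt 0 hφ).differentiableAt
    have hO := isBigO_norm_sq_of_differentiableAt hsd hs0
    refine hasDerivAt_of_abs_sub_le (hasDerivAt_const 0 0) (by rw [hm0, Real.negMulLog_zero])
      (fun t ht => ?_) (isLittleO_mul_log_sq hO)
    rw [sub_zero, abs_of_nonneg (meanEnergy_cfc_negMulLog_nonneg (posSemidef_reducedA _)
      (by rw [trace_reducedA, hnorm, one_pow]) _), norm_slice_sq]
    -- Here s = t²; the expectation of the reduced state is itself O(t²), so the bound is o(t).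
    exact meanEnergy_cfc_negMulLog_le (posSemidef_reducedA _) he1 (by positivity)
  · have hr := hasDerivAt_norm_slice_sq hφ e
    have hd : DifferentiableAt ℝ
        (fun t => Matrix.toEuclideanLin (reducedA (φ t)) e - (p : ℂ) • e) 0 :=
      (differentiableAt_reducedA hφ.differentiableAt e).sub_const _
    have hO := isBigO_norm_sq_of_differentiableAt hd (by rw [he, sub_self])
    refine hasDerivAt_of_abs_sub_le
      (((hr.sub_const p).const_mul (-Real.log p - 1)).const_add (Real.negMulLog p))
      (by simp [hm0, hr0]) (fun t _ => abs_meanEnergy_cfc_negMulLog_sub_le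
        (posSemidef_reducedA (φ t)) he1 hp) ?_
    simp only [div_eq_inv_mul]
    exact (hO.const_mul_left _).trans_isLittleO isLittleO_sq

/-- First-order perturbation of the entanglement entropy, also at degenerate and vanishing
Schmidt coefficients. -/
theorem hasDerivAt_entropy {φ : ℝ → BiVec dA dB} {φ' : BiVec dA dB}
    (hφ : HasDerivAt φ φ' 0) (hnorm : ∀ t, ‖φ t‖ = 1) {ι : Type*} [Fintype ι]
    (e : OrthonormalBasis ι ℂ (EuclideanSpace ℂ (Fin dA))) {p : ι → ℝ} (hp : ∀ i, 0 ≤ p i)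
    (he : ∀ i, Matrix.toEuclideanLin (reducedA (φ 0)) (e i) = (p i : ℂ) • e i) :
    HasDerivAt (fun t => entropy (reducedA (φ t)))
      (-∑ i, Real.log (p i) * (2 * (inner ℂ (slice (e i) (φ 0)) (slice (e i) φ')).re)) 0 := by
  have h := HasDerivAt.fun_sum fun i (_ : i ∈ Finset.univ) =>
    hasDerivAt_meanEnergy_cfc_negMulLog hφ hnorm (e.norm_eq_one i) (hp i) (he i)
  -- The trace stays 1, so the contributions of the -1 in -log p - 1 cancel in the sum.
  have htr : HasDerivAt (fun _ : ℝ => (1 : ℝ))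
      (∑ i, 2 * (inner ℂ (slice (e i) (φ 0)) (slice (e i) φ')).re) 0 := by
    have h1 := HasDerivAt.fun_sum fun i (_ : i ∈ Finset.univ) =>
      hasDerivAt_norm_slice_sq hφ (e i)
    refine h1.congr_of_eventuallyEq (Eventually.of_forall fun t => ?_)
    beta_reduce
    rw [← trace_re_eq_sum e, trace_reducedA, hnorm, one_pow]
  have h0 := htr.unique (hasDerivAt_const (0 : ℝ) (1 : ℝ))
  simp only [entropy, trace_re_eq_sum e]
  refine h.congr_deriv ?_
  simp only [sub_mul, Finset.sum_sub_distrib, one_mul, neg_mul, Finset.sum_neg_distrib]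
  rw [h0, sub_zero]

end Derivative

/-! ### Unitary evolution and energy variance -/

section Evolution

variable {n : Type*} [Fintype n] [DecidableEq n]

lemma evolution_zero (H : Matrix n n ℂ) : evolution H 0 = 1 := by
  simp [evolution]

lemma conjTranspose_evolution_mul {H : Matrix n n ℂ} (hH : H.IsHermitian) (t : ℝ) :
    (evolution H t)ᴴ * evolution H t = 1 := by
  have h : ((-(Complex.I * (t : ℂ))) • H)ᴴ = -((-(Complex.I * (t : ℂ))) • H) := by
    rw [Matrix.conjTranspose_smul, hH.eq, ← neg_smul]
    simp
  rw [evolution, ← Matrix.exp_conjTranspose, h,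
    ← Matrix.exp_add_of_commute _ _ (Commute.refl ((-(Complex.I * (t : ℂ))) • H)).neg_left,
    neg_add_cancel, NormedSpace.exp_zero]

lemma norm_evolution {H : Matrix n n ℂ} (hH : H.IsHermitian) (t : ℝ) (ψ : EuclideanSpace ℂ n) :
    ‖Matrix.toEuclideanLin (evolution H t) ψ‖ = ‖ψ‖ := by
  have h : inner ℂ (Matrix.toEuclideanLin (evolution H t) ψ)
      (Matrix.toEuclideanLin (evolution H t) ψ) = inner ℂ ψ ψ := by
    rw [← LinearMap.adjoint_inner_right, ← Matrix.toEuclideanLin_conjTranspose_eq_adjoint,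
      ← LinearMap.comp_apply, ← Matrix.toLpLin_mul_same, conjTranspose_evolution_mul hH,
      Matrix.toLpLin_one, LinearMap.id_apply]
  simp only [inner_self_eq_norm_sq_to_K] at h
  norm_cast at h
  exact (sq_eq_sq₀ (norm_nonneg _) (norm_nonneg _)).1 h

lemma mul_pureState_mul (U : Matrix n n ℂ) (ψ : EuclideanSpace ℂ n) :
    U * pureState ψ * Uᴴ = pureState (Matrix.toEuclideanLin U ψ) := by
  rw [pureState_eq_vecMulVec, pureState_eq_vecMulVec, Matrix.mul_vecMulVec,
    Matrix.vecMulVec_mul, Matrix.toLpLin_apply, Matrix.star_mulVec]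

open scoped Matrix.Norms.Operator in
lemma hasDerivAt_evolution (H : Matrix n n ℂ) (ψ : EuclideanSpace ℂ n) :
    HasDerivAt (fun t : ℝ => Matrix.toEuclideanLin (evolution H t) ψ)
      (-Complex.I • Matrix.toEuclideanLin H ψ) 0 := by
  have h1 : HasDerivAt (evolution H) (-Complex.I • H) 0 := by
    have h := hasDerivAt_exp_smul_const (𝕂 := ℝ) (-Complex.I • H) (0 : ℝ)
    rw [zero_smul, NormedSpace.exp_zero, one_mul] at h
    refine h.congr_of_eventuallyEq (Filter.Eventually.of_forall fun t => ?_)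
    rw [evolution]
    congr 1
    ext x y
    simp
    ring
  let L : Matrix n n ℂ →L[ℝ] EuclideanSpace ℂ n := LinearMap.toContinuousLinearMap
    ((LinearMap.applyₗ ψ ∘ₗ Matrix.toEuclideanLin.toLinearMap :
      Matrix n n ℂ →ₗ[ℂ] EuclideanSpace ℂ n).restrictScalars ℝ)
  have h2 := L.hasFDerivAt.comp_hasDerivAt 0 h1
  refine h2.congr_deriv ?_
  change Matrix.toEuclideanLin (-Complex.I • H) ψ = _
  rw [map_smul, LinearMap.smul_apply]

lemma energyVariance_eq {H : Matrix n n ℂ} (hH : H.IsHermitian) {ψ : EuclideanSpace ℂ n}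
    (hψ : ‖ψ‖ = 1) :
    energyVariance ψ H =
      ‖Matrix.toEuclideanLin H ψ - (meanEnergy ψ H : ℂ) • ψ‖ ^ 2 := by
  rw [norm_sub_sq_eq_sum hH, energyVariance]
  have h2 : (matElem ψ (H ^ 2) ψ).re = ‖Matrix.toEuclideanLin H ψ‖ ^ 2 := by
    rw [matElem, sq, Matrix.toLpLin_mul_same, LinearMap.comp_apply, ← matElem, matElem_swap hH,
      inner_self_eq_norm_sq_to_K]
    norm_cast
  have h3 := norm_sub_sq_eq_sum hH 0 ψ
  rw [Complex.ofReal_zero, zero_smul, sub_zero] at h3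
  rw [h2, h3]
  have h4 := norm_sq_eq_sum hH ψ
  have h5 := meanEnergy_eq_sum hH ψ
  rw [hψ] at h4
  generalize meanEnergy ψ H = E at *
  simp only [sub_sq, sub_zero, mul_add, mul_sub, Finset.sum_add_distrib, Finset.sum_sub_distrib,
    ← Finset.sum_mul]
  have h6 : ∑ j, ‖inner ℂ (hH.eigenvectorBasis j) ψ‖ ^ 2 * (2 * hH.eigenvalues j * E) =
      2 * E * E := by
    conv_rhs => arg 2; rw [h5]
    rw [Finset.mul_sum]
    exact Finset.sum_congr rfl fun j _ => by ring
  rw [h6, ← h4]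
  ring

/-- Shifting the energy by a real constant alters only the real part. Taking `E` to be the mean
energy brings in the variance. -/
lemma im_matElem_eq {H : Matrix n n ℂ} {u ψ : EuclideanSpace ℂ n} (E : ℝ)
    (hu : (inner ℂ u ψ : ℂ).im = 0) :
    (matElem u H ψ).im = (inner ℂ u (Matrix.toEuclideanLin H ψ - (E : ℂ) • ψ) : ℂ).im := by
  rw [inner_sub_right, inner_smul_right, Complex.sub_im, Complex.im_ofReal_mul, hu, matElem]
  simp

end Evolution

/-! ### The generation rate and its bound by the variance -/

section Rate

variable {dA dB : ℕ}

/-- Since φ' = -iHψ and Re(-iz) = Im z, real parts become imaginary parts. The eigenbasis is left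
free so that it can later extend a Schmidt family. -/
theorem hasDerivAt_entanglementAt {ψ : BiVec dA dB} (hψ : ‖ψ‖ = 1) {H : BiOp dA dB}
    (hH : H.IsHermitian) {ι : Type*} [Fintype ι]
    (e : OrthonormalBasis ι ℂ (EuclideanSpace ℂ (Fin dA))) {p : ι → ℝ} (hp : ∀ i, 0 ≤ p i)
    (he : ∀ i, Matrix.toEuclideanLin (reducedA ψ) (e i) = (p i : ℂ) • e i) :
    HasDerivAt (entanglementAt ψ H)
      (-∑ i, Real.log (p i) * (2 * (matElem (prodVec (e i) (slice (e i) ψ)) H ψ).im)) 0 := by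
  have hnorm (t) : ‖Matrix.toEuclideanLin (evolution H t) ψ‖ = 1 := by
    rw [norm_evolution hH, hψ]
  have h0 : Matrix.toEuclideanLin (evolution H 0) ψ = ψ := by
    rw [evolution_zero, Matrix.toLpLin_one, LinearMap.id_apply]
  have h := hasDerivAt_entropy (hasDerivAt_evolution H ψ) hnorm e hp (by rwa [h0])
  rw [h0] at h
  have hE : entanglementAt ψ H =
      fun t => entropy (reducedA (Matrix.toEuclideanLin (evolution H t) ψ)) := by
    ext t
    rw [entanglementAt, mul_pureState_mul, relEntropyEntanglement_pureState (hnorm t)]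
  rw [hE]
  refine h.congr_deriv ?_
  congr 1
  refine Finset.sum_congr rfl fun i _ => ?_
  rw [← inner_prodVec_left, inner_smul_right, ← matElem]
  simp

theorem differentiableAt_entanglementAt {ψ : BiVec dA dB} (hψ : ‖ψ‖ = 1) {H : BiOp dA dB}
    (hH : H.IsHermitian) : DifferentiableAt ℝ (entanglementAt ψ H) 0 :=
  (hasDerivAt_entanglementAt hψ hH (posSemidef_reducedA ψ).1.eigenvectorBasis
    (posSemidef_reducedA ψ).eigenvalues_nonneg
    (toEuclideanLin_eigenvectorBasis (posSemidef_reducedA ψ).1)).differentiableAt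

/-- Nonzero slices are pairwise orthogonal in ℂ^dB. This makes the rate bound depend on min(dA, dB)
rather than on dA. -/
lemma card_slice_ne_zero_le {ψ : BiVec dA dB} {ι : Type*} [Fintype ι]
    (e : OrthonormalBasis ι ℂ (EuclideanSpace ℂ (Fin dA))) {p : ι → ℝ}
    (he : ∀ i, Matrix.toEuclideanLin (reducedA ψ) (e i) = (p i : ℂ) • e i) :
    Fintype.card {i // slice (e i) ψ ≠ 0} ≤ min dA dB := by
  refine le_min ?_ ?_
  · refine (Fintype.card_subtype_le _).trans_eq ?_
    rw [← Module.finrank_eq_card_basis e.toBasis, finrank_euclideanSpace_fin]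
  · have hli : LinearIndependent ℂ fun i : {i // slice (e i) ψ ≠ 0} => slice (e i) ψ := by
      refine linearIndependent_of_ne_zero_of_inner_eq_zero (fun i => i.2) fun i j hij => ?_
      beta_reduce
      rw [inner_slice_slice, matElem, he, inner_smul_right,
        e.inner_eq_zero (fun h => hij (Subtype.ext h.symm)), mul_zero]
    simpa using hli.fintype_card_le_finrank

lemma abs_log_sq_mul_le {x : ℝ} (h0 : 0 ≤ x) (h1 : x ≤ 1) : |Real.log (x ^ 2)| * x ≤ 2 := by
  rcases h0.eq_or_lt with rfl | h0
  · simp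
  · have h := (Real.abs_log_mul_self_lt x h0 h1).le
    rw [abs_mul, abs_of_pos h0] at h
    rw [Real.log_pow, abs_mul]
    norm_num
    linarith

/-- Each nonzero slice, of norm x ≤ 1, contributes at most 2 · |log x²| · x · √ΔE² ≤ 4√ΔE²; zero
slices contribute nothing. -/
theorem abs_entRate_le {ψ : BiVec dA dB} (hψ : ‖ψ‖ = 1) {H : BiOp dA dB} (hH : H.IsHermitian) :
    |entRate ψ H| ≤ 4 * min dA dB * √(energyVariance ψ H) := by
  have hρ := posSemidef_reducedA ψ
  set e := hρ.1.eigenvectorBasis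
  set p := hρ.1.eigenvalues
  have he (i) : Matrix.toEuclideanLin (reducedA ψ) (e i) = (p i : ℂ) • e i :=
    toEuclideanLin_eigenvectorBasis hρ.1 i
  have hnorm (i) : p i = ‖slice (e i) ψ‖ ^ 2 := by
    rw [norm_slice_sq, meanEnergy, matElem, he, inner_smul_right, inner_self_eq_norm_sq_to_K,
      e.norm_eq_one]
    simp
  have hle (i) : ‖slice (e i) ψ‖ ≤ 1 := by
    have h1 := trace_re_eq_sum e (reducedA ψ)
    rw [trace_reducedA, hψ] at h1
    have h2 := Finset.single_le_sum (f := fun i => meanEnergy (e i) (reducedA ψ))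
      (fun k _ => meanEnergy_nonneg hρ _) (Finset.mem_univ i)
    rw [← h1, one_pow, ← norm_slice_sq] at h2
    exact (sq_le_one_iff₀ (norm_nonneg _)).1 h2
  have hvar : √(energyVariance ψ H) =
      ‖Matrix.toEuclideanLin H ψ - (meanEnergy ψ H : ℂ) • ψ‖ := by
    rw [energyVariance_eq hH hψ, Real.sqrt_sq (norm_nonneg _)]
  have hterm (i) :
      |Real.log (p i) * (2 * (matElem (prodVec (e i) (slice (e i) ψ)) H ψ).im)| ≤
        if slice (e i) ψ ≠ 0 then 4 * √(energyVariance ψ H) else 0 := by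
    split_ifs with h
    · have him : (inner ℂ (prodVec (e i) (slice (e i) ψ)) ψ : ℂ).im = 0 := by
        rw [inner_prodVec_left, inner_self_eq_norm_sq_to_K]
        norm_cast
      rw [im_matElem_eq (meanEnergy ψ H) him, hnorm i, hvar]
      set χ := Matrix.toEuclideanLin H ψ - (meanEnergy ψ H : ℂ) • ψ
      have h1 : |(inner ℂ (prodVec (e i) (slice (e i) ψ)) χ : ℂ).im| ≤
          ‖slice (e i) ψ‖ * ‖χ‖ := by
        refine (Complex.abs_im_le_norm _).trans ((norm_inner_le_norm _ _).trans_eq ?_)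
        rw [norm_prodVec, e.norm_eq_one, one_mul]
      have h2 := abs_log_sq_mul_le (norm_nonneg (slice (e i) ψ)) (hle i)
      calc _ = 2 * (|Real.log (‖slice (e i) ψ‖ ^ 2)| *
            |(inner ℂ (prodVec (e i) (slice (e i) ψ)) χ : ℂ).im|) := by
            rw [abs_mul, abs_mul, abs_two]; ring
        _ ≤ 2 * (|Real.log (‖slice (e i) ψ‖ ^ 2)| * (‖slice (e i) ψ‖ * ‖χ‖)) := by gcongr
        _ = 2 * ((|Real.log (‖slice (e i) ψ‖ ^ 2)| * ‖slice (e i) ψ‖) * ‖χ‖) := by ring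
        _ ≤ 2 * (2 * ‖χ‖) := by gcongr
        _ = _ := by ring
    · rw [hnorm i, not_not.1 h]
      simp
  rw [entRate, (hasDerivAt_entanglementAt hψ hH e hρ.eigenvalues_nonneg he).deriv, abs_neg]
  calc _ ≤ ∑ i, if slice (e i) ψ ≠ 0 then 4 * √(energyVariance ψ H) else 0 :=
        (Finset.abs_sum_le_sum_abs _ _).trans (Finset.sum_le_sum fun i _ => hterm i)
    _ = Fintype.card {i // slice (e i) ψ ≠ 0} * (4 * √(energyVariance ψ H)) := by
        rw [← Finset.sum_filter, Finset.sum_const, nsmul_eq_mul, Fintype.card_subtype]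
    _ ≤ (min dA dB : ℕ) * (4 * √(energyVariance ψ H)) := by
        gcongr
        exact card_slice_ne_zero_le e he
    _ = _ := by push_cast; ring

end Rate

/-! ### The rate in a Schmidt basis -/

section Schmidt

variable {dA dB : ℕ} {ψ : BiVec dA dB} {C : Fin (min dA dB) → ℝ}
  {a : Fin (min dA dB) → EuclideanSpace ℂ (Fin dA)}
  {b : Fin (min dA dB) → EuclideanSpace ℂ (Fin dB)}

lemma orthonormal_prodVec (ha : Orthonormal ℂ a) (hb : Orthonormal ℂ b) :
    Orthonormal ℂ fun i => prodVec (a i) (b i) := by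
  refine ⟨fun i => by rw [norm_prodVec, ha.1, hb.1, one_mul], fun i j hij => ?_⟩
  beta_reduce
  rw [inner_prodVec, ha.2 hij, zero_mul]

lemma IsSchmidt.inner_prodVec (h : IsSchmidt ψ C a b) (i : Fin (min dA dB)) :
    inner ℂ (prodVec (a i) (b i)) ψ = (C i : ℂ) := by
  conv_lhs => rw [h.decomp]
  exact (orthonormal_prodVec h.orthoA h.orthoB).inner_right_fintype (fun i => (C i : ℂ)) i

lemma IsSchmidt.imagCoeff_eq (h : IsSchmidt ψ C a b) (H : BiOp dA dB) (i : Fin (min dA dB)) :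
    imagCoeff H C a b i = (matElem (prodVec (a i) (b i)) H ψ).im := by
  rw [imagCoeff]
  conv_rhs => rw [h.decomp]
  simp only [matElem, map_sum, inner_sum, Complex.im_sum, map_smul, inner_smul_right,
    Complex.im_ofReal_mul]
  exact Finset.sum_congr rfl fun j _ => mul_comm _ _

lemma IsSchmidt.slice_eq (h : IsSchmidt ψ C a b) (e : EuclideanSpace ℂ (Fin dA)) :
    slice e ψ = ∑ j, ((C j : ℂ) * inner ℂ e (a j)) • b j := by
  refine ext_inner_left ℂ fun w => ?_
  conv_lhs => rw [← inner_prodVec_left, h.decomp]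
  simp only [inner_sum, inner_smul_right, EntRate.inner_prodVec, mul_assoc]

/-- Bessel's inequality for (H - ⟨H⟩)ψ against the orthonormal vectors |ii⟩. -/
theorem IsSchmidt.sum_imagCoeff_sq_le (h : IsSchmidt ψ C a b) (hψ : ‖ψ‖ = 1) {H : BiOp dA dB}
    (hH : H.IsHermitian) : ∑ i, imagCoeff H C a b i ^ 2 ≤ energyVariance ψ H := by
  rw [energyVariance_eq hH hψ]
  refine le_trans (Finset.sum_le_sum fun i _ => ?_)
    ((orthonormal_prodVec h.orthoA h.orthoB).sum_inner_products_le _ (s := Finset.univ))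
  rw [h.imagCoeff_eq, im_matElem_eq (meanEnergy ψ H) (by rw [h.inner_prodVec, Complex.ofReal_im]),
    ← sq_abs]
  gcongr
  exact Complex.abs_im_le_norm _

theorem IsSchmidt.entRate_eq (h : IsSchmidt ψ C a b) (hψ : ‖ψ‖ = 1) {H : BiOp dA dB}
    (hH : H.IsHermitian) :
    entRate ψ H = -4 * ∑ i, imagCoeff H C a b i * (C i * Real.log (C i)) := by
  let c : Fin (min dA dB) → Fin dA := Fin.castLE (min_le_left _ _)
  have hc : Function.Injective c := Fin.castLE_injective _
  -- The Schmidt family on A is completed to an orthonormal basis; the added vectors have zero slice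
  -- and eigenvalue 0.
  obtain ⟨e, he⟩ : ∃ e : OrthonormalBasis (Fin dA) ℂ (EuclideanSpace ℂ (Fin dA)),
      ∀ i, e (c i) = a i := by
    have hext (i) : Function.extend c a 0 (c i) = a i := hc.extend_apply a 0 i
    have ho : Orthonormal ℂ ((Set.range c).domRestrict (Function.extend c a 0)) := by
      have h1 := h.orthoA.comp _ (Equiv.ofInjective c hc).symm.injective
      convert h1 using 1
      ext1 x
      obtain ⟨i, rfl⟩ := (Equiv.ofInjective c hc).surjective x
      rw [Set.domRestrict_apply, Function.comp_apply, Equiv.symm_apply_apply,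
        Equiv.ofInjective_apply, hext]
    obtain ⟨e, he⟩ := ho.exists_orthonormalBasis_extension_of_card_eq (by simp)
    exact ⟨e, fun i => (he _ ⟨i, rfl⟩).trans (hext i)⟩
  let p : Fin dA → ℝ := Function.extend c (fun i => C i ^ 2) 0
  have hpc (i) : p (c i) = C i ^ 2 := hc.extend_apply _ _ i
  have hpn {x} (hx : x ∉ Set.range c) : p x = 0 := Function.extend_apply' _ _ _ hx
  have hs (i) : slice (e (c i)) ψ = (C i : ℂ) • b i := by
    rw [h.slice_eq, Finset.sum_eq_single i]
    · rw [he, inner_self_eq_norm_sq_to_K, h.orthoA.1]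
      simp
    · intro j _ hj
      rw [he, h.orthoA.2 hj.symm, mul_zero, zero_smul]
    · simp
  have hsn {x} (hx : x ∉ Set.range c) : slice (e x) ψ = 0 := by
    rw [h.slice_eq]
    refine Finset.sum_eq_zero fun j _ => ?_
    rw [← he, e.inner_eq_zero (fun hxj => hx ⟨j, hxj.symm⟩), mul_zero, zero_smul]
  have hρ (x) : Matrix.toEuclideanLin (reducedA ψ) (e x) = (p x : ℂ) • e x := by
    refine InnerProductSpace.ext_inner_left_basis (𝕜 := ℂ) e.toBasis fun y => ?_
    rw [OrthonormalBasis.coe_toBasis, ← matElem, ← inner_slice_slice, inner_smul_right]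
    by_cases hx : x ∈ Set.range c
    · obtain ⟨i, rfl⟩ := hx
      by_cases hy : y ∈ Set.range c
      · obtain ⟨j, rfl⟩ := hy
        rw [hs, hs, inner_smul_left, inner_smul_right, hpc]
        by_cases hij : i = j
        · subst hij
          rw [inner_self_eq_norm_sq_to_K, inner_self_eq_norm_sq_to_K, h.orthoB.1, e.norm_eq_one]
          simp [sq]
        · rw [h.orthoB.2 hij, e.inner_eq_zero (fun h => hij (hc h.symm))]
          simp
      · rw [hsn hy, inner_zero_right, e.inner_eq_zero (fun h => hy ⟨i, h.symm⟩), mul_zero]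
    · rw [hsn hx, inner_zero_left, hpn hx, Complex.ofReal_zero, zero_mul]
  have hp0 (x) : 0 ≤ p x := by
    by_cases hx : x ∈ Set.range c
    · obtain ⟨i, rfl⟩ := hx
      rw [hpc]
      positivity
    · rw [hpn hx]
  rw [entRate, (hasDerivAt_entanglementAt hψ hH e hp0 hρ).deriv,
    ← Fintype.sum_of_injective c hc
      (fun i => 4 * (imagCoeff H C a b i * (C i * Real.log (C i)))) _
      (fun x hx => by rw [hpn hx, Real.log_zero, zero_mul]) fun i => ?_]
  · rw [← Finset.mul_sum, neg_mul]
  · have hm : matElem (prodVec (a i) ((C i : ℂ) • b i)) H ψ =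
        (C i : ℂ) * matElem (prodVec (a i) (b i)) H ψ := by
      rw [prodVec_smul_right, matElem, inner_smul_left, Complex.conj_ofReal, matElem]
    -- The factor 4 is the 2 of the derivative formula times the 2 from log C² = 2 log C.
    rw [hs, he, hpc, hm, Complex.im_ofReal_mul, ← h.imagCoeff_eq, Real.log_pow]
    push_cast
    ring

end Schmidt

/-! ### Unbounded rate at fixed mean energy -/

section Unbounded

/-- The Hamiltonian `e + s (i |u⟩⟨v| - i |v⟩⟨u|)`. -/
def swapHamiltonian {n : Type*} [DecidableEq n] (u v : EuclideanSpace ℂ n) (e s : ℝ) :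
    Matrix n n ℂ :=
  (e : ℂ) • 1 + (s : ℂ) • (Complex.I • Matrix.vecMulVec (u : n → ℂ) (star (v : n → ℂ)) -
    Complex.I • Matrix.vecMulVec (v : n → ℂ) (star (u : n → ℂ)))

variable {n : Type*} [Fintype n] [DecidableEq n]

omit [Fintype n] in
lemma isHermitian_swapHamiltonian (u v : EuclideanSpace ℂ n) (e s : ℝ) :
    (swapHamiltonian u v e s).IsHermitian := by
  simp only [Matrix.IsHermitian, swapHamiltonian, Matrix.conjTranspose_add,
    Matrix.conjTranspose_sub, Matrix.conjTranspose_smul, Matrix.conjTranspose_one,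
    Matrix.conjTranspose_vecMulVec, star_star, RCLike.star_def, Complex.conj_ofReal,
    Complex.conj_I]
  module

lemma toEuclideanLin_swapHamiltonian (u v : EuclideanSpace ℂ n) (e s : ℝ)
    (ψ : EuclideanSpace ℂ n) :
    Matrix.toEuclideanLin (swapHamiltonian u v e s) ψ = (e : ℂ) • ψ +
      (s : ℂ) • ((Complex.I * inner ℂ v ψ) • u - (Complex.I * inner ℂ u ψ) • v) := by
  have hv (x y : EuclideanSpace ℂ n) : Matrix.toEuclideanLin
      (Matrix.vecMulVec (x : n → ℂ) (star (y : n → ℂ))) ψ = (inner ℂ y ψ : ℂ) • x := by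
    rw [Matrix.toLpLin_apply, Matrix.vecMulVec_mulVec, EuclideanSpace.inner_eq_star_dotProduct,
      dotProduct_comm]
    ext i
    simp [mul_comm]
  simp only [swapHamiltonian, map_add, map_smul, map_sub, LinearMap.add_apply,
    LinearMap.smul_apply, LinearMap.sub_apply, hv, Matrix.toLpLin_one, LinearMap.id_apply,
    smul_smul]

theorem exists_entRate_unbounded {dA dB : ℕ} (hA : 2 ≤ dA) (hB : 2 ≤ dB) :
    ∃ ψ : BiVec dA dB, ‖ψ‖ = 1 ∧ ∀ e K : ℝ, ∃ H : BiOp dA dB, H.IsHermitian ∧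
      meanEnergy ψ H = e ∧ K < entRate ψ H := by
  have hd : 2 ≤ min dA dB := le_min hA hB
  let i₀ : Fin (min dA dB) := ⟨0, by omega⟩
  let i₁ : Fin (min dA dB) := ⟨1, by omega⟩
  have h01 : i₀ ≠ i₁ := by simp [i₀, i₁]
  -- A rational point of the unit circle with unequal positive coordinates; equal ones would make
  -- the rate vanish.
  let C : Fin (min dA dB) → ℝ := fun i => if i = i₀ then 3 / 5 else if i = i₁ then 4 / 5 else 0
  have hC0 : C i₀ = 3 / 5 := if_pos rfl
  have hC1 : C i₁ = 4 / 5 := by simp [C, h01.symm]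
  have hC {i} (hi : i ≠ i₀ ∧ i ≠ i₁) : C i = 0 := by simp [C, hi.1, hi.2]
  let a : Fin (min dA dB) → EuclideanSpace ℂ (Fin dA) :=
    fun i => EuclideanSpace.single (Fin.castLE (min_le_left _ _) i) 1
  let b : Fin (min dA dB) → EuclideanSpace ℂ (Fin dB) :=
    fun i => EuclideanSpace.single (Fin.castLE (min_le_right _ _) i) 1
  have ha : Orthonormal ℂ a :=
    EuclideanSpace.orthonormal_single.comp _ (Fin.castLE_injective _)
  have hb : Orthonormal ℂ b :=
    EuclideanSpace.orthonormal_single.comp _ (Fin.castLE_injective _)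
  have hu := orthonormal_prodVec ha hb
  set u := fun i => prodVec (a i) (b i)
  let ψ : BiVec dA dB := ∑ i, (C i : ℂ) • u i
  have hS : IsSchmidt ψ C a b := ⟨fun i => by dsimp only [C]; split_ifs <;> norm_num, ha, hb, rfl⟩
  have hin (i) : inner ℂ (u i) ψ = (C i : ℂ) := hS.inner_prodVec i
  have hin' (i) : inner ℂ ψ (u i) = (C i : ℂ) := by
    rw [← inner_conj_symm, hin, Complex.conj_ofReal]
  have hψ : ‖ψ‖ = 1 := by
    have h1 : inner ℂ ψ ψ = ((∑ i, C i * C i : ℝ) : ℂ) := by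
      conv_lhs => arg 3; rw [show ψ = ∑ i, (C i : ℂ) • u i from rfl]
      rw [inner_sum, Complex.ofReal_sum]
      exact Finset.sum_congr rfl fun i _ => by rw [inner_smul_right, hin', Complex.ofReal_mul]
    rw [Fintype.sum_eq_add i₀ i₁ h01 (fun i hi => by rw [hC hi, zero_mul]), hC0, hC1] at h1
    replace h1 : ‖ψ‖ ^ 2 = 3 / 5 * (3 / 5) + 4 / 5 * (4 / 5) :=
      (inner_self_eq_norm_sq (𝕜 := ℂ) ψ).symm.trans (congrArg Complex.re h1)
    norm_num only at h1
    exact (pow_eq_one_iff_of_nonneg (norm_nonneg _) two_ne_zero).1 h1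
  refine ⟨ψ, hψ, fun e K => ?_⟩
  -- The rate at coupling strength 1, namely 4 · (3/5)(4/5) · log((4/5)/(3/5)); the rate is linear
  -- in s, so s = (K + 1)/g gives K + 1.
  set g : ℝ := 48 / 25 * Real.log (4 / 3)
  have hg : 0 < g := mul_pos (by norm_num) (Real.log_pos (by norm_num))
  set s : ℝ := (K + 1) / g
  have hH := isHermitian_swapHamiltonian (u i₀) (u i₁) e s
  have hHψ := toEuclideanLin_swapHamiltonian (u i₀) (u i₁) e s ψ
  rw [hin, hin] at hHψ
  refine ⟨_, hH, ?_, ?_⟩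
  -- The overlaps of ψ with both vectors are real, so the two coupling terms cancel and only e
  -- remains.
  · rw [meanEnergy, matElem, hHψ]
    simp only [inner_add_right, inner_smul_right, inner_sub_right, hin',
      inner_self_eq_norm_sq_to_K, hψ]
    simp
  · have hk (i) : imagCoeff (swapHamiltonian (u i₀) (u i₁) e s) C a b i =
        s * (C i₁ * (if i = i₀ then 1 else 0) - C i₀ * (if i = i₁ then 1 else 0)) := by
      rw [hS.imagCoeff_eq, matElem, hHψ]
      change (inner ℂ (u i) _ : ℂ).im = _
      simp only [inner_add_right, inner_smul_right, inner_sub_right, hin,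
        orthonormal_iff_ite.1 hu]
      split_ifs <;> simp
    rw [hS.entRate_eq hψ hH,
      Fintype.sum_eq_add i₀ i₁ h01 (fun i hi => by rw [hC hi, zero_mul, mul_zero]), hk, hk,
      if_pos rfl, if_pos rfl, if_neg h01, if_neg h01.symm, hC0, hC1]
    have hlog : Real.log (4 / 3) = Real.log (4 / 5) - Real.log (3 / 5) := by
      rw [← Real.log_div (by norm_num) (by norm_num)]
      norm_num
    have hsg : s * g = K + 1 := div_mul_cancel₀ _ hg.ne'
    have : -4 * (s * (4 / 5 * 1 - 3 / 5 * 0) * (3 / 5 * Real.log (3 / 5)) +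
        s * (4 / 5 * 0 - 3 / 5 * 1) * (4 / 5 * Real.log (4 / 5))) = s * g := by
      simp only [g, hlog]
      ring
    rw [this, hsg]
    linarith

end Unbounded

end EntRate

end

theorem proposition2 :
    -- the entanglement is differentiable at time zero, so that the rate is a true derivative
    (∀ (dA dB : ℕ) (ψ : EntRate.BiVec dA dB) (H : EntRate.BiOp dA dB),
      ‖ψ‖ = 1 → H.IsHermitian → DifferentiableAt ℝ (EntRate.entanglementAt ψ H) 0) ∧
    -- mean energy alone does not bound the rate, even for one fixed state
    (∀ dA dB : ℕ, 2 ≤ dA → 2 ≤ dB → ∃ ψ : EntRate.BiVec dA dB, ‖ψ‖ = 1 ∧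
      ∀ e K : ℝ, ∃ H : EntRate.BiOp dA dB, H.IsHermitian ∧
        EntRate.meanEnergy ψ H = e ∧ K < EntRate.entRate ψ H) ∧
    -- bounded variance: the rate is bounded uniformly over states and Hamiltonians
    (∀ (d : ℕ) (b : ℝ), ∃ K : ℝ, ∀ dA dB : ℕ, min dA dB = d →
      ∀ (ψ : EntRate.BiVec dA dB) (H : EntRate.BiOp dA dB), ‖ψ‖ = 1 → H.IsHermitian →
        EntRate.energyVariance ψ H ≤ b → |EntRate.entRate ψ H| ≤ K) ∧
    -- the formula for the rate in any Schmidt basis, and the bound on its coefficients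
    (∀ (dA dB : ℕ) (ψ : EntRate.BiVec dA dB) (H : EntRate.BiOp dA dB),
      ‖ψ‖ = 1 → H.IsHermitian →
      ∀ (C : Fin (min dA dB) → ℝ) (a : Fin (min dA dB) → EuclideanSpace ℂ (Fin dA))
        (b : Fin (min dA dB) → EuclideanSpace ℂ (Fin dB)), EntRate.IsSchmidt ψ C a b →
        EntRate.entRate ψ H =
          -4 * ∑ i, EntRate.imagCoeff H C a b i * (C i * Real.log (C i)) ∧
        ∑ i, EntRate.imagCoeff H C a b i ^ 2 ≤ EntRate.energyVariance ψ H) := by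
  refine ⟨fun _ _ _ _ hψ hH => EntRate.differentiableAt_entanglementAt hψ hH,
    fun _ _ hA hB => EntRate.exists_entRate_unbounded hA hB,
    -- No sign condition on b is needed: `√` is monotone on all of ℝ, with value 0 at negative
    -- arguments.
    fun d b => ⟨4 * d * √b, ?_⟩,
    fun _ _ _ _ hψ hH _ _ _ hS => ⟨hS.entRate_eq hψ hH, hS.sum_imagCoeff_sq_le hψ hH⟩⟩
  rintro dA dB rfl ψ H hψ hH hb
  refine (EntRate.abs_entRate_le hψ hH).trans ?_
  push_cast
  gcongr
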